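/- Let $N\ge 4$ be even, let $g>0$ (gauge coupling) and $a>0$ (area). Write $\chi_R$ for the character of a finite-dimensional continuous complex representation $R$ of $\mathrm{SU}(N)$, and $C_2(R)$ for its quadratic Casimir invariant if $R$ is irreducible, i.e. the eigenvalue of $-\sum_a \mathrm{d}R(X_a)^2$ for an orthonormal basis $(X_a)$ of $\mathfrak{su}(N)$ with respect to $-\mathrm{Tr}(XY)$. Two-dimensional $\mathrm{SU}(N)$ Yang–Mills theory is understood through its exact (Migdal–Rusakov) solution: its sectors are the isomorphism classes of irreducible representations $R$ of $\mathrm{SU}(N)$, with energy $E(R)=\tfrac{g^2}{2}C_2(R)$; on a disk of area $a$ with Wilson loop $W_R$ along the boundary and the topological point operator $V[U]$ labelled by the conjugacy class of $U\in\mathrm{SU}(N)$ in the interior, $$\langle V[U]\,W_R\rangle=\chi_R(U)\,\mathrm{e}^{-aE(R)} ,$$ and the sector $R$ contributes $(\dim R)^{2-2h}\,\mathrm{e}^{-aE(R)}\,\chi_R(U)/\dim R$ to the partition function with $V[U]$ inserted on the closed oriented surface of genus $h$ and area $a$. Gauging the non-invertible 1-form symmetry $\mathrm{SO}(N)^{\#}$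 (the operators $V[U]$ labelled by conjugacy classes of $\mathrm{SO}(N)\subset\mathrm{SU}(N)$, which are invariant under charge conjugation $\mathcal{C}:U\mapsto\overline U$) with generalized $\theta$-angle the character $\chi_{\kappa}$ of the vector representation $\kappa$ of $\mathrm{SO}(N)$ means integrating these quantities over $U\in\mathrm{SO}(N)$ against $\chi_\kappa(U)\,\mathrm{d}U$, where $\mathrm{d}U$ is the normalized Haar measure. An irreducible $R$ survives if its Wilson loop in the orbifold, $$\int_{\mathrm{SO}(N)}\mathrm{d}U\ \chi_\kappa(U)\,\langle V[U]\,W_R\rangle ,$$ is non-zero; a vacuum is a surviving $R$ of minimal energy $E(R)$ among all surviving ones. Charge conjugation acts on the sectors by $R\mapsto\overline R=R\circ\mathcal{C}$. Proposition 4.3 (SSB in the $\mathrm{SO}(N)^{\#}$ non-invertible orbifold). In this orbifold theory the fundamental representation $\Box$ and the antifundamental representation $\overline\Box$ both survive and have equal energy; they are non-isomorphic, are exchanged by $\mathcal{C}$, and are, up to isomorphism, precisely the vacua. Consequently charge conjugation is spontaneously broken: $\mathcal{C}$ is a symmetry of the orbifold theory (for irreducible $R$, also $\overline R$ is irreducible,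 and $R$, $\overline R$ have the same energy, the same orbifold Wilson loop and the same contribution to the orbifold partition function on every closed oriented surface), the set of vacua is non-empty and mapped to itself by $\mathcal{C}$, and no vacuum is fixed by $\mathcal{C}$. -/

import Mathlib

open MeasureTheory
open scoped Matrix

noncomputable section

namespace YM2

/-! ## The groups `SU(N)` and `SO(N)` -/

/-- The gauge group `SU(N)`. -/
abbrev SU (N : ℕ) : Type := Matrix.specialUnitaryGroup (Fin N) ℂ

/-- The group `SO(N)` of real special orthogonal matrices. -/
abbrev SO (N : ℕ) : Type := Matrix.specialOrthogonalGroup (Fin N) ℝ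

instance instIsTopologicalGroupSO (N : ℕ) : IsTopologicalGroup (SO N) where
  continuous_inv := by
    refine Continuous.subtype_mk ?_ _
    exact (continuous_subtype_val (p := fun A => A ∈ Matrix.specialUnitaryGroup (Fin N) ℝ)).star

instance instCompactSpaceSO (N : ℕ) : CompactSpace (SO N) := by
  apply isCompact_iff_compactSpace.mp
  have hK : IsCompact (Set.pi Set.univ fun _ : Fin N => Set.pi Set.univ fun _ : Fin N =>
      Metric.closedBall (0 : ℝ) 1) :=
    isCompact_univ_pi fun _ => isCompact_univ_pi fun _ => isCompact_closedBall _ _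
  refine hK.of_isClosed_subset ?_ ?_
  · have h : ((Matrix.specialUnitaryGroup (Fin N) ℝ : Set (Matrix (Fin N) (Fin N) ℝ))) =
        {A | A * star A = 1} ∩ {A | A.det = 1} := by
      ext A
      simp [Matrix.mem_specialUnitaryGroup_iff, Matrix.mem_unitaryGroup_iff]
    rw [h]
    refine IsClosed.inter (isClosed_eq ?_ continuous_const) (isClosed_eq ?_ continuous_const)
    · exact Continuous.mul continuous_id
        (continuous_star (R := Matrix (Fin N) (Fin N) ℝ))
    · exact continuous_id.matrix_det
  · intro A hA i _ j _
    have := entry_norm_bound_of_unitary (Matrix.mem_specialUnitaryGroup_iff.mp hA).1 i j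
    simpa using this

instance instMeasurableSpaceSO (N : ℕ) : MeasurableSpace (SO N) := borel _

instance instBorelSpaceSO (N : ℕ) : BorelSpace (SO N) := ⟨rfl⟩

/-- The Haar measure of `SO(N)` of total mass one. -/
def haarSO (N : ℕ) : Measure (SO N) := Measure.haarMeasure ⊤

/-- The standard embedding `SO(N) → SU(N)`: a real matrix is read as a complex one. -/
def inclSO (N : ℕ) : SO N →* SU N where
  toFun h := ⟨(h : Matrix (Fin N) (Fin N) ℝ).map Complex.ofRealHom, by
    obtain ⟨A, hA⟩ := h
    rw [Matrix.mem_specialUnitaryGroup_iff] at hA ⊢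
    obtain ⟨h1, h2⟩ := hA
    rw [Matrix.mem_unitaryGroup_iff] at h1
    refine ⟨?_, ?_⟩
    · rw [Matrix.mem_unitaryGroup_iff]
      have : star (A.map Complex.ofRealHom) = (star A).map Complex.ofRealHom := by
        ext i j; simp [Matrix.star_apply]
      simp only [this]
      rw [← Matrix.map_mul, h1]
      simp
    · have := (Complex.ofRealHom.map_det A).symm
      simp only [RingHom.mapMatrix_apply] at this
      simp only [this, h2, map_one]⟩
  map_one' := Subtype.ext (Matrix.map_one _ (map_zero _) (map_one _))
  map_mul' x y := Subtype.ext (Matrix.map_mul (f := Complex.ofRealHom))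

/-- Charge conjugation, the automorphism `U ↦ Ū` (entrywise complex conjugation) of `SU(N)`. -/
def chargeConj (N : ℕ) : SU N →* SU N where
  toFun U := ⟨(U : Matrix (Fin N) (Fin N) ℂ).map (starRingEnd ℂ), by
    obtain ⟨A, hA⟩ := U
    rw [Matrix.mem_specialUnitaryGroup_iff] at hA ⊢
    obtain ⟨h1, h2⟩ := hA
    rw [Matrix.mem_unitaryGroup_iff] at h1
    refine ⟨?_, ?_⟩
    · rw [Matrix.mem_unitaryGroup_iff]
      have : star (A.map (starRingEnd ℂ)) = (star A).map (starRingEnd ℂ) := by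
        ext i j; simp [Matrix.star_apply]
      simp only [this]
      rw [← Matrix.map_mul, h1]
      simp
    · have := ((starRingEnd ℂ).map_det A).symm
      simp only [RingHom.mapMatrix_apply] at this
      simp only [this, h2, map_one]⟩
  map_one' := Subtype.ext (Matrix.map_one _ (map_zero _) (map_one _))
  map_mul' x y := Subtype.ext (Matrix.map_mul (f := starRingEnd ℂ))

lemma continuous_inclSO (N : ℕ) : Continuous (inclSO N) :=
  Continuous.subtype_mk (continuous_subtype_val.matrix_map Complex.continuous_ofReal) _

lemma continuous_chargeConj (N : ℕ) : Continuous (chargeConj N) :=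
  Continuous.subtype_mk (continuous_subtype_val.matrix_map Complex.continuous_conj) _

/-! ## Finite-dimensional representations -/

/-- A continuous finite-dimensional complex representation of a topological group. Up to
isomorphism every such representation acts on some `ℂ^d`. -/
structure CRep (G : Type) [Group G] [TopologicalSpace G] where
  dim : ℕ
  rep : Representation ℂ G (Fin dim → ℂ)
  continuous_rep : ∀ v, Continuous fun g => rep g v

/-- Isomorphism of representations. -/
def CRep.Iso {G : Type} [Group G] [TopologicalSpace G] (R S : CRep G) : Prop :=
  Nonempty (R.rep.Equiv S.rep)

/-- The pullback of a representation along a continuous homomorphism. -/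
def CRep.pullback {G H : Type} [Group G] [TopologicalSpace G] [Group H] [TopologicalSpace H]
    (R : CRep G) (f : H →* G) (hf : Continuous f) : CRep H where
  dim := R.dim
  rep := MonoidHom.comp R.rep f
  continuous_rep v := (R.continuous_rep v).comp hf

/-- The fundamental representation of `SU(N)`: matrices acting on `ℂ^N`. -/
def fundamental (N : ℕ) : CRep (SU N) where
  dim := N
  rep := MonoidHom.comp (Matrix.toLinAlgEquiv' : Matrix (Fin N) (Fin N) ℂ ≃ₐ[ℂ] _)
    (Matrix.specialUnitaryGroup (Fin N) ℂ).subtype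
  continuous_rep v := by
    change Continuous fun U : SU N => (U : Matrix (Fin N) (Fin N) ℂ) *ᵥ v
    exact continuous_subtype_val.matrix_mulVec continuous_const

/-- The action of charge conjugation on representations, `R ↦ R̄ = R ∘ 𝒞`. -/
def CRep.conj {N : ℕ} (R : CRep (SU N)) : CRep (SU N) :=
  R.pullback (chargeConj N) (continuous_chargeConj N)

/-- The antifundamental representation of `SU(N)`: `U` acts on `ℂ^N` as the matrix `Ū`. -/
def antifundamental (N : ℕ) : CRep (SU N) where
  dim := N
  rep := MonoidHom.comp (Matrix.toLinAlgEquiv' : Matrix (Fin N) (Fin N) ℂ ≃ₐ[ℂ] _)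
    ((Matrix.specialUnitaryGroup (Fin N) ℂ).subtype.comp (chargeConj N))
  continuous_rep v := by
    change Continuous fun U : SU N => (chargeConj N U : Matrix (Fin N) (Fin N) ℂ) *ᵥ v
    exact (continuous_subtype_val.comp (continuous_chargeConj N)).matrix_mulVec continuous_const

/-- The (complexified) vector representation of `SO(N)`: matrices acting on `ℂ^N`. -/
def vectorRep (N : ℕ) : CRep (SO N) :=
  (fundamental N).pullback (inclSO N) (continuous_inclSO N)

/-! ## The quadratic Casimir invariant of `SU(N)` -/

lemma det_exp_of_skew {N : ℕ} {X : Matrix (Fin N) (Fin N) ℂ} (hX : Xᴴ = -X) :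
    (NormedSpace.exp X).det = Complex.exp X.trace := by
  have hH : (-Complex.I • X).IsHermitian := by
    rw [Matrix.IsHermitian, Matrix.conjTranspose_smul, hX]
    simp
  set U := hH.eigenvectorUnitary with hU
  have hUU : (U : Matrix (Fin N) (Fin N) ℂ) * star (U : Matrix (Fin N) (Fin N) ℂ) = 1 :=
    Unitary.mul_star_self_of_mem U.2
  have hinv : star (U : Matrix (Fin N) (Fin N) ℂ) = (U : Matrix (Fin N) (Fin N) ℂ)⁻¹ :=
    (Matrix.inv_eq_right_inv hUU).symm
  have hunit : IsUnit (U : Matrix (Fin N) (Fin N) ℂ) :=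
    IsUnit.of_mul_eq_one _ hUU
  have hdet : IsUnit (U : Matrix (Fin N) (Fin N) ℂ).det :=
    (Matrix.isUnit_iff_isUnit_det _).mp hunit
  set D : Fin N → ℂ := fun i => Complex.I * (hH.eigenvalues i : ℂ) with hD
  have hspec : X = (U : Matrix (Fin N) (Fin N) ℂ) * Matrix.diagonal D *
      (U : Matrix (Fin N) (Fin N) ℂ)⁻¹ := by
    have h1 := hH.spectral_theorem
    rw [Unitary.conjStarAlgAut_apply, ← hU, hinv] at h1
    have h2 : X = Complex.I • (-Complex.I • X) := by
      rw [smul_smul]; simp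
    rw [h2, h1, ← Matrix.smul_mul, ← Matrix.mul_smul]
    congr 2
    ext i j
    by_cases hij : i = j
    · subst hij; simp [hD]
    · simp [hij]
  rw [hspec, Matrix.exp_conj _ _ hunit, Matrix.det_conj hunit, Matrix.exp_diagonal,
    Matrix.det_diagonal, Matrix.trace_mul_cycle, Matrix.nonsing_inv_mul _ hdet, Matrix.one_mul,
    Matrix.trace_diagonal, Complex.exp_sum]
  refine Finset.prod_congr rfl fun i _ => ?_
  rw [Pi.coe_exp, Complex.exp_eq_exp_ℂ]

/-- The Lie algebra `su(N)` of traceless anti-Hermitian matrices. -/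
def su (N : ℕ) : Set (Matrix (Fin N) (Fin N) ℂ) := {X | Xᴴ = -X ∧ X.trace = 0}

/-- The one-parameter subgroup `t ↦ exp (t X)` of `SU(N)` generated by `X ∈ su(N)`. -/
def oneParam {N : ℕ} (X : su N) (t : ℝ) : SU N :=
  ⟨NormedSpace.exp ((t : ℂ) • (X : Matrix (Fin N) (Fin N) ℂ)), by
    obtain ⟨X, hX, htr⟩ := X
    have hs : ((t : ℂ) • X)ᴴ = -((t : ℂ) • X) := by
      rw [Matrix.conjTranspose_smul, hX]; simp
    rw [Matrix.mem_specialUnitaryGroup_iff, Matrix.mem_unitaryGroup_iff]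
    refine ⟨?_, ?_⟩
    · rw [Matrix.star_eq_conjTranspose, ← Matrix.exp_conjTranspose, hs,
        ← Matrix.exp_add_of_commute _ _ (Commute.refl ((t : ℂ) • X)).neg_right, add_neg_cancel,
        NormedSpace.exp_zero]
    · rw [det_exp_of_skew hs, Matrix.trace_smul, htr]; simp⟩

/-- The orthogonal projections to `su(N)`, for the invariant inner product `-Tr (X Y)`, of the
orthonormal basis of `u(N)` made of `(E_jk - E_kj)/√2` (`j < k`), `i (E_jk + E_kj)/√2` (`k < j`)
and `i E_jj`. Being the projection of an orthonormal basis, the family represents the inverse of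
the inner product of `su(N)`: see `sum_frame`. -/
def frameMatrix (N : ℕ) (p : Fin N × Fin N) : Matrix (Fin N) (Fin N) ℂ :=
  if p.1 < p.2 then
    ((Real.sqrt 2 : ℂ)⁻¹) • (Matrix.single p.1 p.2 1 - Matrix.single p.2 p.1 1)
  else if p.2 < p.1 then
    (Complex.I * (Real.sqrt 2 : ℂ)⁻¹) • (Matrix.single p.1 p.2 1 + Matrix.single p.2 p.1 1)
  else Complex.I • (Matrix.single p.1 p.1 1 - (N : ℂ)⁻¹ • (1 : Matrix (Fin N) (Fin N) ℂ))

/-- The family `frameMatrix`, as elements of `su(N)`. -/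
def frame (N : ℕ) (p : Fin N × Fin N) : su N :=
  ⟨frameMatrix N p, by
    have hN : (N : ℂ) ≠ 0 := by
      have : 0 < N := lt_of_le_of_lt (Nat.zero_le _) p.1.2
      exact_mod_cast this.ne'
    unfold frameMatrix
    split_ifs with h1 h2
    · refine ⟨?_, ?_⟩
      · simp [Matrix.conjTranspose_smul]
        rw [← smul_neg, neg_sub]
      · simp [Matrix.trace_single_eq_of_ne _ _ _ h1.ne, Matrix.trace_single_eq_of_ne _ _ _ h1.ne']
    · refine ⟨?_, ?_⟩
      · rw [Matrix.conjTranspose_smul, ← neg_smul]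
        simp [add_comm]
      · simp [Matrix.trace_single_eq_of_ne _ _ _ h2.ne, Matrix.trace_single_eq_of_ne _ _ _ h2.ne']
    · refine ⟨?_, ?_⟩
      · simp [Matrix.conjTranspose_smul]
      · simp [hN]⟩

/-- `frame` resolves the identity of `su(N)` for the inner product `-Tr (X Y)`, so that
`∑ F_p ⊗ F_p = ∑ X_a ⊗ X_a` for each orthonormal basis `X_a` of `su(N)`. -/
lemma sum_frame {N : ℕ} (X : su N) :
    ∑ p : Fin N × Fin N, (-(frameMatrix N p * X).trace) • frameMatrix N p =
      (X : Matrix (Fin N) (Fin N) ℂ) := by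
  obtain ⟨X, hX, htr⟩ := X
  set T : Fin N × Fin N → Matrix (Fin N) (Fin N) ℂ :=
    fun p => (-(frameMatrix N p * X).trace) • frameMatrix N p with hT
  set S : Fin N × Fin N → Matrix (Fin N) (Fin N) ℂ := fun p =>
    X p.1 p.2 • Matrix.single p.1 p.2 1 -
      (if p.1 = p.2 then X p.1 p.1 * (N : ℂ)⁻¹ else 0) • (1 : Matrix (Fin N) (Fin N) ℂ) with hS
  have h2 : ((Real.sqrt 2 : ℝ) : ℂ)⁻¹ * ((Real.sqrt 2 : ℝ) : ℂ)⁻¹ = 1 / 2 := by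
    rw [← mul_inv, ← Complex.ofReal_mul, Real.mul_self_sqrt (by norm_num)]; norm_num
  have hlt : ∀ j k : Fin N, j < k → T (j, k) + T (k, j) = S (j, k) + S (k, j) := by
    intro j k hjk
    have e1 : T (j, k) = ((X j k - X k j) / 2) •
        (Matrix.single j k (1 : ℂ) - Matrix.single k j 1) := by
      simp only [hT, frameMatrix, hjk, if_true, Matrix.smul_mul, Matrix.trace_smul,
        Matrix.sub_mul, Matrix.trace_sub, Matrix.trace_single_mul, smul_smul, smul_eq_mul, one_mul]
      congr 1
      linear_combination (X j k - X k j) * h2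
    have e2 : T (k, j) = ((X j k + X k j) / 2) •
        (Matrix.single k j (1 : ℂ) + Matrix.single j k 1) := by
      simp only [hT, frameMatrix, hjk, hjk.not_gt, if_true, if_false, Matrix.smul_mul,
        Matrix.trace_smul, Matrix.add_mul, Matrix.trace_add, Matrix.trace_single_mul, smul_smul,
        smul_eq_mul, one_mul]
      congr 1
      linear_combination (-Complex.I ^ 2) * (X j k + X k j) * h2 -
        (X j k + X k j) / 2 * Complex.I_sq
    rw [e1, e2]
    simp only [hS, hjk.ne, hjk.ne', if_false, zero_smul, sub_zero]
    module
  have hall : ∀ p, T p + T p.swap = S p + S p.swap := by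
    rintro ⟨j, k⟩
    rcases lt_trichotomy j k with h | h | h
    · exact hlt j k h
    · subst h
      have e : T (j, j) = S (j, j) := by
        simp only [hT, hS, frameMatrix, lt_irrefl, if_true, if_false, Matrix.smul_mul,
          Matrix.trace_smul, Matrix.sub_mul, Matrix.trace_sub, Matrix.trace_single_mul, smul_smul,
          smul_eq_mul, one_mul, htr, mul_zero, sub_zero]
        rw [show -(Complex.I * X j j) * Complex.I = X j j by
          linear_combination (-X j j) * Complex.I_sq]
        rw [smul_sub, smul_smul]
      simp [e]
    · have := hlt k j h
      simp only [Prod.swap_prod_mk]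
      rw [add_comm, this, add_comm]
  have hsw : ∀ f : Fin N × Fin N → Matrix (Fin N) (Fin N) ℂ, ∑ p, f (Prod.swap p) = ∑ p, f p :=
    fun f => Equiv.sum_comp (Equiv.prodComm (Fin N) (Fin N)) f
  have hsum : (2 : ℂ) • ∑ p, T p = (2 : ℂ) • ∑ p, S p := by
    have := Finset.sum_congr rfl fun p (_ : p ∈ Finset.univ) => hall p
    rw [Finset.sum_add_distrib, Finset.sum_add_distrib, hsw, hsw] at this
    rw [two_smul, two_smul, this]
  have hTS : ∑ p, T p = ∑ p, S p := smul_right_injective _ (two_ne_zero) hsum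
  change ∑ p, T p = X
  rw [hTS]
  simp only [hS, Finset.sum_sub_distrib, ← Finset.sum_smul]
  have htr' : ∑ p : Fin N × Fin N, (if p.1 = p.2 then X p.1 p.1 * (N : ℂ)⁻¹ else 0) = 0 := by
    rw [Fintype.sum_prod_type]
    simp only [Finset.sum_ite_eq, Finset.mem_univ, if_true, ← Finset.sum_mul]
    rw [show ∑ i, X i i = 0 from htr, zero_mul]
  rw [htr', zero_smul, sub_zero, Fintype.sum_prod_type]
  conv_rhs => rw [Matrix.matrix_eq_sum_single X]
  simp

/-- The matrix of the operator `dR(X) = d/dt R(exp (t X))` at `t = 0`. -/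
def CRep.lie {N : ℕ} (R : CRep (SU N)) (X : su N) : Matrix (Fin R.dim) (Fin R.dim) ℂ :=
  Matrix.of fun a b => deriv (fun t : ℝ => R.rep (oneParam X t) (Pi.single b 1) a) 0

/-- The quadratic Casimir operator `-∑ dR(X)²` of `su(N)` in the representation `R`. -/
def CRep.casimirOperator {N : ℕ} (R : CRep (SU N)) : Matrix (Fin R.dim) (Fin R.dim) ℂ :=
  -∑ p : Fin N × Fin N, R.lie (frame N p) * R.lie (frame N p)

/-- The quadratic Casimir invariant `C₂(R)` of an irreducible representation. The Casimir operator
is then a real multiple of the identity, and the factor is its normalized trace. -/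
def CRep.casimir {N : ℕ} (R : CRep (SU N)) : ℝ := (R.casimirOperator.trace / R.dim).re

/-! ## Two-dimensional Yang-Mills theory and its orbifold by `SO(N)^#`

The theory is given by its exact (Migdal-Rusakov) solution: the states on a circle are spanned by
the irreducible representations `R` of `SU(N)`, the state `R` has the energy `(g²/2) C₂(R)`, and a
surface of area `a` contributes `exp (-a (g²/2) C₂(R))` in the sector `R`. -/

/-- The energy of the sector `R` at gauge coupling `g`. -/
def energy {N : ℕ} (g : ℝ) (R : CRep (SU N)) : ℝ := g ^ 2 / 2 * R.casimir

/-- The correlator `⟨V[U] W_R⟩` on a disk of area `a`, with the topological point operator labelled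
by the conjugacy class of `U` inserted and the Wilson loop `W_R` running along the boundary. -/
def diskCorrelator {N : ℕ} (g a : ℝ) (U : SU N) (R : CRep (SU N)) : ℂ :=
  R.rep.character U * Real.exp (-a * energy g R)

/-- The contribution of the sector `R` to the partition function on the closed oriented surface of
genus `h` and area `a` with the topological point operator `V[U]` inserted:
`(dim R)^χ exp (-a (g²/2) C₂(R)) χ_R(U) / dim R`, where `χ = 2 - 2 h`. -/
def closedSector {N : ℕ} (g a : ℝ) (h : ℕ) (U : SU N) (R : CRep (SU N)) : ℂ :=
  (R.dim : ℂ) ^ (2 - 2 * (h : ℤ)) * Real.exp (-a * energy g R) * (R.rep.character U / R.dim)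

/-- The Wilson loop `⟨W_R⟩` on a disk of area `a` in the orbifold by `SO(N)^#` with generalized
`θ`-angle `κ`: the insertions `V[U]` are integrated over `SO(N)` with the weight `χ_κ(U)`. The
integrand is a class function, so this is an integral over the conjugacy classes of `SO(N)`. -/
def orbifoldWilson {N : ℕ} (κ : CRep (SO N)) (g a : ℝ) (R : CRep (SU N)) : ℂ :=
  ∫ u, κ.rep.character u * diskCorrelator g a (inclSO N u) R ∂haarSO N

/-- The contribution of the sector `R` to the partition function of the same orbifold on the closed
oriented surface of genus `h` and area `a`. -/
def orbifoldSector {N : ℕ} (κ : CRep (SO N)) (g a : ℝ) (h : ℕ) (R : CRep (SU N)) : ℂ :=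
  ∫ u, κ.rep.character u * closedSector g a h (inclSO N u) R ∂haarSO N

/-- The sector of the irreducible representation `R` survives in the orbifold: its Wilson loop is
not projected out. -/
def Survives {N : ℕ} (κ : CRep (SO N)) (g a : ℝ) (R : CRep (SU N)) : Prop :=
  R.rep.IsIrreducible ∧ orbifoldWilson κ g a R ≠ 0

/-- A vacuum of the orbifold: a surviving sector of lowest energy among all surviving ones. -/
def IsVacuum {N : ℕ} (κ : CRep (SO N)) (g a : ℝ) (R : CRep (SU N)) : Prop :=
  Survives κ g a R ∧ ∀ S : CRep (SU N), Survives κ g a S → energy g R ≤ energy g S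

/-- Charge conjugation is a symmetry of the orbifold: its action `R ↦ R̄` on the sectors preserves
irreducibility, energies, Wilson loops and contributions to partition functions. -/
def ChargeConjSymmetric {N : ℕ} (κ : CRep (SO N)) (g a : ℝ) : Prop :=
  ∀ R : CRep (SU N), R.rep.IsIrreducible →
    R.conj.rep.IsIrreducible ∧ energy g R.conj = energy g R ∧
    orbifoldWilson κ g a R.conj = orbifoldWilson κ g a R ∧
    ∀ h : ℕ, orbifoldSector κ g a h R.conj = orbifoldSector κ g a h R

/-- Spontaneous breaking of charge conjugation in the orbifold: it is a symmetry of the theory,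
there are vacua, and it maps every vacuum to a different one. -/
def ChargeConjSSB {N : ℕ} (κ : CRep (SO N)) (g a : ℝ) : Prop :=
  ChargeConjSymmetric κ g a ∧ (∃ R, IsVacuum κ g a R) ∧
    ∀ R, IsVacuum κ g a R → IsVacuum κ g a R.conj ∧ ¬ R.conj.Iso R

end YM2

end

/-! Everything is read off from the weights of the maximal torus. A weight is recorded as an integer
vector m of length N with sum zero and all entries congruent modulo N, the true weight being m/N
(`exists_weight`, `IsWeightBasis.sum_eq_zero`, `IsWeightBasis.dvd_sub`).

Casimir: each frame element of su(N) is SU(N)-conjugate to a diagonal matrix, so Tr dR(X)² is a sum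
of squared weights. Hence C₂(R) is N + 1 times the mean of |m/N|² over all weights of R
(`IsWeightBasis.casimir_eq`). Highest weight theory is not needed: a bound valid for every weight is
a bound for the mean.

Selection rule: for even N, -1 lies in SO(N) and is central. Translating the Haar integral by -1
flips the sign of χ_κ, so R can survive only if -1 acts as -1, i.e. if all entries of its weights
are odd. The common residue r of the entries modulo N (constant over R by Schur) is then non-zero.

Minimum: a vector m with residue 0 < r < N satisfies |m|² ≥ N r (N - r) ≥ N(N - 1), with equality
only for weights of □ (r = N - 1) or of its conjugate (r = 1); see `weight_norm_bound`. A surviving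
sector of minimal energy thus has only weights of one of these two kinds. Weyl symmetry makes its
character proportional to that of □ or of the conjugate, and orthogonality of characters gives the
isomorphism (`iso_fundamental_of_weights`).

Both candidates survive, since restricted to SO(N) each has the real character Tr and ∫ Tr² > 0. For
N > 2 the center distinguishes them. Charge conjugation fixes SO(N) pointwise and reverses weights,
so it preserves all orbifold data while exchanging the two vacua. -/

noncomputable section

namespace YM2

/-! ## The maximal torus of `SU(N)` -/

/-- The phases `φ_j` minus their mean. -/
def centered {N : ℕ} (φ : Fin N → ℝ) (j : Fin N) : ℝ := φ j - (∑ k, φ k) / N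

lemma sum_centered {N : ℕ} (φ : Fin N → ℝ) : ∑ j, centered φ j = 0 := by
  rcases Nat.eq_zero_or_pos N with rfl | hN
  · simp
  · have : (N : ℝ) ≠ 0 := by positivity
    simp only [centered, Finset.sum_sub_distrib, Finset.sum_const, Finset.card_univ,
      Fintype.card_fin, nsmul_eq_mul]
    field_simp
    ring

lemma centered_of_sum_eq_zero {N : ℕ} {φ : Fin N → ℝ} (h : ∑ j, φ j = 0) : centered φ = φ := by
  funext j; simp [centered, h]

lemma centered_add {N : ℕ} (φ ψ : Fin N → ℝ) : centered (φ + ψ) = centered φ + centered ψ := by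
  funext j
  simp only [centered, Pi.add_apply, Finset.sum_add_distrib]
  ring

lemma centered_smul {N : ℕ} (s : ℝ) (φ : Fin N → ℝ) : centered (s • φ) = s • centered φ := by
  funext j
  simp only [centered, Pi.smul_apply, smul_eq_mul, ← Finset.mul_sum]
  ring

lemma diagonal_mem_unitary {N : ℕ} (ψ : Fin N → ℝ) :
    Matrix.diagonal (fun j => Complex.exp (Complex.I * ψ j)) ∈ Matrix.unitaryGroup (Fin N) ℂ := by
  rw [Matrix.mem_unitaryGroup_iff, Matrix.star_eq_conjTranspose, Matrix.diagonal_conjTranspose,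
    Matrix.diagonal_mul_diagonal, ← Matrix.diagonal_one]
  congr 1
  funext j
  simp only [Pi.star_apply, Complex.star_def, ← Complex.exp_conj, ← Complex.exp_add]
  simp

/-- The parametrization of the diagonal matrices in `SU(N)` by phases, projected to mean zero. -/
def torus {N : ℕ} (φ : Fin N → ℝ) : SU N :=
  ⟨Matrix.diagonal fun j => Complex.exp (Complex.I * centered φ j), by
    rw [Matrix.mem_specialUnitaryGroup_iff]
    refine ⟨diagonal_mem_unitary _, ?_⟩
    rw [Matrix.det_diagonal, ← Complex.exp_sum, ← Finset.mul_sum, ← Complex.ofReal_sum,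
      sum_centered]
    simp⟩

lemma coe_torus {N : ℕ} (φ : Fin N → ℝ) : (torus φ : Matrix (Fin N) (Fin N) ℂ) =
    Matrix.diagonal fun j => Complex.exp (Complex.I * centered φ j) := rfl

lemma torus_add {N : ℕ} (φ ψ : Fin N → ℝ) : torus (φ + ψ) = torus φ * torus ψ := by
  apply Subtype.ext
  rw [Submonoid.coe_mul, coe_torus, coe_torus, coe_torus, Matrix.diagonal_mul_diagonal,
    centered_add]
  congr 1
  funext j
  rw [← Complex.exp_add]
  simp [mul_add]

lemma torus_zero {N : ℕ} : torus (0 : Fin N → ℝ) = 1 := by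
  apply Subtype.ext
  rw [coe_torus, Submonoid.coe_one, ← Matrix.diagonal_one]
  congr 1
  funext j
  simp [centered]

lemma continuous_torus {N : ℕ} : Continuous (torus : (Fin N → ℝ) → SU N) := by
  refine Continuous.subtype_mk (Continuous.matrix_diagonal ?_) _
  unfold centered
  fun_prop

lemma torus_nsmul {N : ℕ} (n : ℕ) (φ : Fin N → ℝ) : torus ((n : ℝ) • φ) = torus φ ^ n := by
  induction n with
  | zero => simp [torus_zero]
  | succ n ih => rw [Nat.cast_succ, add_smul, one_smul, torus_add, ih, pow_succ]

lemma torus_comm {N : ℕ} (φ ψ : Fin N → ℝ) : torus φ * torus ψ = torus ψ * torus φ := by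
  rw [← torus_add, add_comm, torus_add]

/-- Phases which agree modulo `2π` after a common shift give the same element. -/
lemma torus_eq_one {N : ℕ} {φ : Fin N → ℝ} (n : Fin N → ℤ)
    (h : ∀ j, centered φ j = 2 * Real.pi * n j) : torus φ = 1 := by
  apply Subtype.ext
  rw [coe_torus, Submonoid.coe_one, ← Matrix.diagonal_one]
  congr 1
  funext j
  rw [h j, Complex.exp_eq_one_iff]
  exact ⟨n j, by push_cast; ring⟩

/-- The exponential commutes with conjugation, and mean-zero phases are unaffected by centering.
This reduces derivatives of a representation to its weights. -/
lemma oneParam_eq_conj_torus {N : ℕ} (X : su N) (u : SU N) (θ : Fin N → ℝ) (hθ : ∑ j, θ j = 0)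
    (h : (X : Matrix (Fin N) (Fin N) ℂ) = (u : Matrix (Fin N) (Fin N) ℂ) *
      Matrix.diagonal (fun j => Complex.I * θ j) * star (u : Matrix (Fin N) (Fin N) ℂ)) (t : ℝ) :
    oneParam X t = u * torus (t • θ) * u⁻¹ := by
  apply Subtype.ext
  have huu : (u : Matrix (Fin N) (Fin N) ℂ) * star (u : Matrix (Fin N) (Fin N) ℂ) = 1 :=
    Matrix.mem_unitaryGroup_iff.mp (Matrix.mem_specialUnitaryGroup_iff.mp u.2).1
  have hinv : star (u : Matrix (Fin N) (Fin N) ℂ) = (u : Matrix (Fin N) (Fin N) ℂ)⁻¹ :=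
    (Matrix.inv_eq_right_inv huu).symm
  have hunit : IsUnit (u : Matrix (Fin N) (Fin N) ℂ) := IsUnit.of_mul_eq_one _ huu
  change NormedSpace.exp ((t : ℂ) • (X : Matrix (Fin N) (Fin N) ℂ)) =
    (u : Matrix (Fin N) (Fin N) ℂ) * (torus (t • θ) : Matrix (Fin N) (Fin N) ℂ) *
      star (u : Matrix (Fin N) (Fin N) ℂ)
  rw [h, hinv, ← Matrix.smul_mul, ← Matrix.mul_smul, Matrix.exp_conj _ _ hunit,
    ← Matrix.diagonal_smul, Matrix.exp_diagonal, coe_torus]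
  congr 3
  funext j
  rw [Pi.coe_exp, Complex.exp_eq_exp_ℂ, centered_smul, centered_of_sum_eq_zero hθ]
  congr 1
  simp
  ring

/-- A unitary matrix is proportional to an element of `SU(N)`. -/
lemma exists_SU_eq_smul {N : ℕ} (hN : 0 < N) (V : Matrix.unitaryGroup (Fin N) ℂ) :
    ∃ (u : SU N) (c : ℂ), c * star c = 1 ∧
      (u : Matrix (Fin N) (Fin N) ℂ) = c • (V : Matrix (Fin N) (Fin N) ℂ) := by
  set D := (V : Matrix (Fin N) (Fin N) ℂ).det with hD
  have hDn : D * star D = 1 := by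
    have := (Matrix.det_of_mem_unitary V.2)
    exact (Unitary.mem_iff.mp this).2
  -- An N-th root of the conjugate determinant: det (c V) = c^N det V = 1, and |c| = 1 follows.
  obtain ⟨c, hc⟩ := IsAlgClosed.exists_pow_nat_eq (star D) hN
  have hcc : c * star c = 1 := by
    have h1 : ‖c‖ ^ N = 1 := by
      rw [← norm_pow, hc, norm_star]
      have := congrArg norm hDn
      rw [norm_mul, norm_star, norm_one] at this
      nlinarith [norm_nonneg D]
    have h2 : ‖c‖ = 1 := (pow_eq_one_iff_of_nonneg (norm_nonneg _) hN.ne').mp h1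
    rw [Complex.star_def, Complex.mul_conj, Complex.normSq_eq_norm_sq, h2]; simp
  have hVV := Matrix.mem_unitaryGroup_iff.mp V.2
  refine ⟨⟨c • (V : Matrix (Fin N) (Fin N) ℂ), ?_⟩, c, hcc, rfl⟩
  rw [Matrix.mem_specialUnitaryGroup_iff, Matrix.mem_unitaryGroup_iff]
  refine ⟨?_, ?_⟩
  · rw [star_smul, Matrix.smul_mul, Matrix.mul_smul, smul_smul, hVV, hcc, one_smul]
  · rw [Matrix.det_smul, Fintype.card_fin, hc, ← hD, mul_comm, hDn]

/-- Conjugation by a unitary matrix is conjugation by an element of `SU(N)`. -/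
lemma exists_SU_conj {N : ℕ} (hN : 0 < N) (V : Matrix.unitaryGroup (Fin N) ℂ) :
    ∃ u : SU N, ∀ X : Matrix (Fin N) (Fin N) ℂ,
      (u : Matrix (Fin N) (Fin N) ℂ) * X * star (u : Matrix (Fin N) (Fin N) ℂ) =
        (V : Matrix (Fin N) (Fin N) ℂ) * X * star (V : Matrix (Fin N) (Fin N) ℂ) := by
  obtain ⟨u, c, hcc, hu⟩ := exists_SU_eq_smul hN V
  refine ⟨u, fun X => ?_⟩
  rw [hu, star_smul, Matrix.smul_mul, Matrix.smul_mul, Matrix.mul_smul, smul_smul, hcc, one_smul]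

open scoped Matrix.Norms.L2Operator in
/-- A unitary matrix is the exponential of an anti-Hermitian one. -/
lemma exists_isHermitian_exp {N : ℕ} (U : Matrix.unitaryGroup (Fin N) ℂ) :
    ∃ H : Matrix (Fin N) (Fin N) ℂ, H.IsHermitian ∧
      NormedSpace.exp (Complex.I • H) = (U : Matrix (Fin N) (Fin N) ℂ) := by
  -- The spectrum is finite, so even `Complex.arg` with its branch cut is continuous on it and the
  -- functional calculus applies; on the unit circle i arg y = log y.
  have hfin := Matrix.finite_spectrum (U : Matrix (Fin N) (Fin N) ℂ)
  have hcont (f : ℂ → ℂ) : ContinuousOn f (spectrum ℂ (U : Matrix (Fin N) (Fin N) ℂ)) :=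
    hfin.continuousOn f
  have hnorm : IsStarNormal (U : Matrix (Fin N) (Fin N) ℂ) := inferInstance
  refine ⟨cfc (fun z => (Complex.arg z : ℂ)) (U : Matrix (Fin N) (Fin N) ℂ), ?_, ?_⟩
  · change star _ = _
    rw [← cfc_star]
    simp
  · rw [← CFC.exp_eq_normedSpace_exp (𝕜 := ℂ),
      ← cfc_comp_smul _ _ _ (NormedSpace.exp_continuous.continuousOn), ← cfc_comp' (hf := hcont _)
        (hg := by fun_prop)]
    conv_rhs => rw [← cfc_id' ℂ (U : Matrix (Fin N) (Fin N) ℂ)]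
    refine cfc_congr fun y hy ↦ ?_
    have hy₁ : ‖y‖ = 1 := spectrum.norm_eq_one_of_unitary U.2 hy
    have : Complex.I * y.arg = Complex.log y :=
      Complex.ext (by simp [Complex.log_re, hy₁]) (by simp [Complex.log_im])
    simpa [← Complex.exp_eq_exp_ℂ, this] using
      Complex.exp_log (by rintro rfl; simp at hy₁)

lemma exists_conj_torus {N : ℕ} (hN : 0 < N) (g : SU N) :
    ∃ (u : SU N) (φ : Fin N → ℝ), g = u * torus φ * u⁻¹ := by
  have hg := Matrix.mem_specialUnitaryGroup_iff.mp g.2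
  obtain ⟨H, hH, hexp⟩ : ∃ H : Matrix (Fin N) (Fin N) ℂ, H.IsHermitian ∧
      NormedSpace.exp (Complex.I • H) = (g : Matrix (Fin N) (Fin N) ℂ) :=
    exists_isHermitian_exp ⟨(g : Matrix (Fin N) (Fin N) ℂ), hg.1⟩
  set V := hH.eigenvectorUnitary with hV
  have hVV : (V : Matrix (Fin N) (Fin N) ℂ) * star (V : Matrix (Fin N) (Fin N) ℂ) = 1 :=
    Unitary.mul_star_self_of_mem V.2
  have hinv : star (V : Matrix (Fin N) (Fin N) ℂ) = (V : Matrix (Fin N) (Fin N) ℂ)⁻¹ :=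
    (Matrix.inv_eq_right_inv hVV).symm
  have hunit : IsUnit (V : Matrix (Fin N) (Fin N) ℂ) := IsUnit.of_mul_eq_one _ hVV
  have hspec : (g : Matrix (Fin N) (Fin N) ℂ) = (V : Matrix (Fin N) (Fin N) ℂ) *
      Matrix.diagonal (fun j => Complex.exp (Complex.I * hH.eigenvalues j)) *
      star (V : Matrix (Fin N) (Fin N) ℂ) := by
    obtain ⟨d, hd⟩ : ∃ d, d = hH.eigenvalues := ⟨_, rfl⟩
    have h1 := hH.spectral_theorem
    rw [Unitary.conjStarAlgAut_apply, ← hV, hinv, ← hd] at h1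
    rw [← hd, ← hexp, h1, ← Matrix.smul_mul, ← Matrix.mul_smul, Matrix.exp_conj _ _ hunit,
      ← Matrix.diagonal_smul, Matrix.exp_diagonal, hinv]
    congr 3
    funext j
    rw [Pi.coe_exp, Complex.exp_eq_exp_ℂ]
    simp
  have hdet : Complex.exp (Complex.I * ((∑ j, hH.eigenvalues j : ℝ) : ℂ)) = 1 := by
    have := hg.2
    rw [hspec, hinv, Matrix.det_conj hunit, Matrix.det_diagonal, ← Complex.exp_sum,
      ← Finset.mul_sum] at this
    rw [Complex.ofReal_sum]; exact this
  obtain ⟨n, hn⟩ := Complex.exp_eq_one_iff.mp hdet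
  have hn' : (∑ j, hH.eigenvalues j) = n * (2 * Real.pi) := by
    have h2 : Complex.I * ((∑ j, hH.eigenvalues j : ℝ) : ℂ) =
        Complex.I * ((n * (2 * Real.pi) : ℝ) : ℂ) := by
      rw [hn]; push_cast; ring
    exact_mod_cast mul_left_cancel₀ Complex.I_ne_zero h2
  -- The determinant condition only makes the total phase a multiple of 2π. Removing it from one
  -- phase leaves the exponentials unchanged and gives sum zero.
  let j₀ : Fin N := ⟨0, hN⟩
  let φ : Fin N → ℝ := fun j => hH.eigenvalues j - if j = j₀ then n * (2 * Real.pi) else 0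
  have hφ : ∑ j, φ j = 0 := by
    simp only [φ, Finset.sum_sub_distrib, hn']
    simp
  obtain ⟨u, hu⟩ := exists_SU_conj hN V
  refine ⟨u, φ, Subtype.ext ?_⟩
  change (g : Matrix (Fin N) (Fin N) ℂ) = (u : Matrix (Fin N) (Fin N) ℂ) *
    (torus φ : Matrix (Fin N) (Fin N) ℂ) * star (u : Matrix (Fin N) (Fin N) ℂ)
  rw [hu, hspec, coe_torus, centered_of_sum_eq_zero hφ]
  congr 3
  funext j
  simp only [φ]
  split_ifs
  · rw [Complex.exp_eq_exp_iff_exists_int]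
    exact ⟨n, by push_cast; ring⟩
  · simp

/-! ## Weights -/

/-- The primitive I of c satisfies c(t) I(δ) = I(t + δ) - I(t), and I(δ) ≠ 0 for some δ because
I'(0) = 1. So c is differentiable with c' = a c. -/
lemma exists_eq_exp_of_continuous_hom {c : ℝ → ℂ} (hc : Continuous c) (h0 : c 0 = 1)
    (hadd : ∀ s t, c (s + t) = c s * c t) : ∃ a : ℂ, ∀ s, c s = Complex.exp (a * s) := by
  set I : ℝ → ℂ := fun t => ∫ x in (0 : ℝ)..t, c x with hI
  have hId : ∀ t, HasDerivAt I (c t) t := fun t =>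
    intervalIntegral.integral_hasDerivAt_right (hc.intervalIntegrable _ _)
      (hc.stronglyMeasurableAtFilter _ _) hc.continuousAt
  obtain ⟨δ, hδ⟩ : ∃ δ, I δ ≠ 0 := by
    by_contra! h
    have h1 : I = fun _ => 0 := funext h
    have h2 := hId 0
    rw [h1, h0] at h2
    exact one_ne_zero (h2.unique (hasDerivAt_const _ _))
  have hshift : ∀ t, c t * I δ = I (t + δ) - I t := by
    intro t
    have h1 : c t * I δ = ∫ x in (0 : ℝ)..δ, c (t + x) := by
      simp only [hI, hadd, intervalIntegral.integral_const_mul]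
    rw [h1, intervalIntegral.integral_comp_add_left (fun x => c x) t, add_zero]
    simp only [hI]
    rw [intervalIntegral.integral_interval_sub_left] <;> exact hc.intervalIntegrable _ _
  set a : ℂ := (c δ - 1) / I δ with ha
  have hder : ∀ t, HasDerivAt c (a * c t) t := by
    intro t
    have h1 : HasDerivAt (fun t => (I (t + δ) - I t) / I δ) ((c (t + δ) - c t) / I δ) t :=
      (((hId (t + δ)).comp_add_const t δ).sub (hId t)).div_const _
    have h2 : (fun t => (I (t + δ) - I t) / I δ) = c := by
      funext t
      rw [← hshift, mul_div_cancel_right₀ _ hδ]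
    rw [h2, hadd] at h1
    convert h1 using 1
    rw [ha]; ring
  refine ⟨a, fun s => ?_⟩
  have hexp : ∀ t : ℝ, HasDerivAt (fun t : ℝ => Complex.exp (-(a * t))) (-a * Complex.exp (-(a * t))) t := by
    intro t
    have h1 : HasDerivAt (fun t : ℝ => -(a * (t : ℂ))) (-(a * 1)) t :=
      ((Complex.ofRealCLM.hasDerivAt (x := t)).const_mul a).neg
    convert h1.cexp using 1
    ring
  have hconst : ∀ t, HasDerivAt (fun t => c t * Complex.exp (-(a * t))) 0 t := by
    intro t
    refine ((hder t).mul (hexp t)).congr_deriv ?_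
    ring
  have h1 : c s * Complex.exp (-(a * s)) = 1 := by
    have := is_const_of_deriv_eq_zero (fun t => (hconst t).differentiableAt)
      (fun t => (hconst t).deriv) s 0
    simpa [h0] using this
  rw [Complex.exp_neg] at h1
  field_simp [Complex.exp_ne_zero] at h1
  exact h1

/-- A basis of simultaneous eigenvectors of the maximal torus. The `i`-th basis vector has the
weight `∑_j m_ij φ_j / N`. -/
def IsWeightBasis {N : ℕ} (R : CRep (SU N)) (b : Module.Basis (Fin R.dim) ℂ (Fin R.dim → ℂ))
    (m : Fin R.dim → Fin N → ℤ) : Prop :=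
  ∀ i φ, R.rep (torus φ) (b i) = Complex.exp (Complex.I * (((∑ j, m i j * φ j) / N : ℝ) : ℂ)) • b i

/-- The element of the torus with phases in `2π ℚ`. -/
def ratTorus {N : ℕ} (q : Fin N → ℚ) : SU N := torus fun j => 2 * Real.pi * (q j : ℝ)

lemma exists_common_denom {ι : Type*} [Fintype ι] (q : ι → ℚ) :
    ∃ M : ℕ, 0 < M ∧ ∃ n : ι → ℤ, ∀ i, (M : ℝ) * (q i : ℝ) = n i := by
  classical
  refine ⟨∏ i, (q i).den, Finset.prod_pos fun i _ => (q i).den_pos,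
    fun i => (∏ k ∈ Finset.univ.erase i, ((q k).den : ℤ)) * (q i).num, fun i => ?_⟩
  rw [← Finset.mul_prod_erase _ _ (Finset.mem_univ i)]
  have h : ((q i).den : ℝ) * (q i : ℝ) = (q i).num := by
    exact_mod_cast Rat.den_mul_eq_num (q i)
  push_cast
  rw [← h]; ring

lemma ratTorus_pow_eq_one {N : ℕ} (hN : 0 < N) (q : Fin N → ℚ) : ∃ M : ℕ, 0 < M ∧ ratTorus q ^ M = 1 := by
  obtain ⟨M, hM, n, hn⟩ := exists_common_denom q
  -- M clears the denominators of the phases; the extra N clears the one of their mean.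
  refine ⟨N * M, Nat.mul_pos hN hM, ?_⟩
  rw [ratTorus, ← torus_nsmul]
  refine torus_eq_one (fun j => N * n j - ∑ k, n k) fun j => ?_
  have hN' : (N : ℝ) ≠ 0 := by positivity
  simp only [centered, Pi.smul_apply, smul_eq_mul]
  push_cast
  simp only [← hn, ← Finset.mul_sum]
  field_simp

lemma isSemisimple_of_pow_eq_one {V : Type*} [AddCommGroup V] [Module ℂ V] [FiniteDimensional ℂ V]
    {f : Module.End ℂ V} {M : ℕ} (hM : 0 < M) (h : f ^ M = 1) : f.IsSemisimple := by
  refine Module.End.isSemisimple_of_squarefree_aeval_eq_zero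
    (p := Polynomial.X ^ M - Polynomial.C (1 : ℂ)) ?_ (by simp [h])
  exact (Polynomial.separable_X_pow_sub_C (1 : ℂ) (by exact_mod_cast hM.ne') one_ne_zero).squarefree

lemma CRep.continuous_rep_apply {G : Type} [Group G] [TopologicalSpace G] (R : CRep G)
    {X : Type*} [TopologicalSpace X] {f : X → G} (hf : Continuous f) (v : Fin R.dim → ℂ) :
    Continuous fun x => R.rep (f x) v := (R.continuous_rep v).comp hf

/-- Common eigenvectors of the torsion elements of the torus span. -/
lemma span_common_eigenvectors {N : ℕ} (hN : 0 < N) (R : CRep (SU N)) :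
    Submodule.span ℂ {v : Fin R.dim → ℂ | v ≠ 0 ∧ ∀ q, ∃ c : ℂ, R.rep (ratTorus q) v = c • v} = ⊤ := by
  -- Finite order already makes these operators semisimple, so no invariant inner product is
  -- required; being commuting, they are simultaneously diagonalizable.
  have hss : ∀ q : Fin N → ℚ, Module.End.IsSemisimple (R.rep (ratTorus q)) := by
    intro q
    obtain ⟨M, hM, h⟩ := ratTorus_pow_eq_one hN q
    exact isSemisimple_of_pow_eq_one hM (by rw [← map_pow, h, map_one])
  have hcomm : Pairwise fun p q : Fin N → ℚ => Commute (R.rep (ratTorus p)) (R.rep (ratTorus q)) := by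
    intro p q _
    change _ * _ = _ * _
    rw [← map_mul, ← map_mul, ratTorus, ratTorus, torus_comm]
  have key := Module.End.iSup_iInf_maxGenEigenspace_eq_top_of_iSup_maxGenEigenspace_eq_top_of_commute
    (fun q : Fin N → ℚ => R.rep (ratTorus q)) hcomm fun q => by
      rw [(hss q).iSup_maxGenEigenspace_eq_top_iff]
      exact (hss q).iSup_eigenspace_eq_top
  rw [eq_top_iff, ← key, iSup_le_iff]
  intro χ v hv
  rcases eq_or_ne v 0 with rfl | hv0
  · exact Submodule.zero_mem _
  refine Submodule.subset_span ⟨hv0, fun q => ⟨χ q, ?_⟩⟩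
  rw [Submodule.mem_iInf] at hv
  have := hv q
  rw [(hss q).isFinitelySemisimple.maxGenEigenspace_eq_eigenspace] at this
  exact Module.End.mem_eigenspace_iff.mp this

lemma dense_ratTorus_phases {N : ℕ} :
    DenseRange fun (q : Fin N → ℚ) (j : Fin N) => 2 * Real.pi * (q j : ℝ) := by
  have h1 : DenseRange fun (q : Fin N → ℚ) (j : Fin N) => (q j : ℝ) :=
    DenseRange.piMap fun _ => Rat.denseRange_cast
  have h2 : Function.Surjective fun (x : Fin N → ℝ) (j : Fin N) => 2 * Real.pi * x j := fun y =>
    ⟨fun j => y j / (2 * Real.pi), by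
      funext j
      have := Real.pi_ne_zero
      simp only
      field_simp⟩
  exact h2.denseRange.comp h1 (by fun_prop)

/-- A common eigenvector of the torsion elements of the torus is a weight vector. -/
lemma exists_weight {N : ℕ} (hN : 0 < N) (R : CRep (SU N)) {v : Fin R.dim → ℂ} (hv : v ≠ 0)
    (h : ∀ q, ∃ c : ℂ, R.rep (ratTorus q) v = c • v) :
    ∃ m : Fin N → ℤ, ∀ φ, R.rep (torus φ) v =
      Complex.exp (Complex.I * (((∑ j, m j * φ j) / N : ℝ) : ℂ)) • v := by
  -- Staying on the line of v is a closed condition, and it holds on the dense set of rational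
  -- phases.
  have hall : ∀ φ, R.rep (torus φ) v ∈ Submodule.span ℂ {v} := by
    intro φ
    have hcl : IsClosed {φ : Fin N → ℝ | R.rep (torus φ) v ∈ Submodule.span ℂ {v}} :=
      (Submodule.closed_of_finiteDimensional (Submodule.span ℂ {v})).preimage
        (R.continuous_rep_apply continuous_torus v)
    have := dense_ratTorus_phases.induction_on (p := fun φ => R.rep (torus φ) v ∈ Submodule.span ℂ {v})
      φ hcl fun q => ?_
    · exact this
    · obtain ⟨c, hc⟩ := h q
      exact Submodule.mem_span_singleton.mpr ⟨c, hc.symm⟩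
  obtain ⟨k, hk⟩ : ∃ k, v k ≠ 0 := Function.ne_iff.mp hv
  set c : (Fin N → ℝ) → ℂ := fun φ => R.rep (torus φ) v k / v k with hcdef
  have hc : ∀ φ, R.rep (torus φ) v = c φ • v := by
    intro φ
    obtain ⟨a, ha⟩ := Submodule.mem_span_singleton.mp (hall φ)
    have : c φ = a := by
      simp only [hcdef, ← ha, Pi.smul_apply, smul_eq_mul]
      field_simp
    rw [this, ha]
  have hinj : ∀ {a b : ℂ}, a • v = b • v → a = b := fun hab => smul_left_injective ℂ hv hab
  have hcont : Continuous c :=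
    ((continuous_apply k).comp (R.continuous_rep_apply continuous_torus v)).div_const _
  have hc1 : ∀ φ, torus φ = 1 → c φ = 1 := by
    intro φ hφ
    apply hinj
    rw [← hc, hφ, map_one, one_smul, Module.End.one_apply]
  have hc0 : c 0 = 1 := hc1 0 torus_zero
  have hadd : ∀ φ ψ, c (φ + ψ) = c φ * c ψ := by
    intro φ ψ
    apply hinj
    rw [← hc, torus_add, map_mul, Module.End.mul_apply, hc ψ, map_smul, hc φ, smul_smul, mul_comm]
  have hline : ∀ j : Fin N, ∃ a : ℂ, ∀ s : ℝ, c (s • Pi.single j 1) = Complex.exp (a * s) := by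
    intro j
    refine exists_eq_exp_of_continuous_hom (hcont.comp (by fun_prop)) (by simpa using hc0) ?_
    intro s t
    rw [add_smul, hadd]
  choose a ha using hline
  have hsum : ∀ φ, c φ = Complex.exp (∑ j, a j * φ j) := by
    intro φ
    have h1 : φ = ∑ j, φ j • (Pi.single j 1 : Fin N → ℝ) := by
      conv_lhs => rw [pi_eq_sum_univ' φ]
    have h2 : ∀ s : Finset (Fin N), c (∑ j ∈ s, φ j • (Pi.single j 1 : Fin N → ℝ)) =
        ∏ j ∈ s, c (φ j • Pi.single j 1) := by
      intro s
      classical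
      induction s using Finset.induction_on with
      | empty => simpa using hc0
      | insert i s hi ih => rw [Finset.sum_insert hi, hadd, ih, Finset.prod_insert hi]
    conv_lhs => rw [h1, h2]
    rw [Complex.exp_sum]
    exact Finset.prod_congr rfl fun j _ => ha j _
  -- The phases 2πN e_j have mean 2π, so they give the identity; hence N a_j ∈ iℤ.
  have hint : ∀ j, ∃ m : ℤ, a j = Complex.I * (m / N) := by
    intro j
    have hN' : (N : ℝ) ≠ 0 := by positivity
    have h1 : torus ((2 * Real.pi * N) • Pi.single j 1 : Fin N → ℝ) = 1 := by
      refine torus_eq_one (fun k => (if k = j then (N : ℤ) else 0) - 1) fun k => ?_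
      simp only [centered, Pi.smul_apply, smul_eq_mul, ← Finset.mul_sum,
        Pi.single_apply, Finset.sum_ite_eq', Finset.mem_univ, if_true]
      rcases eq_or_ne k j with rfl | hkj
      · simp only [if_true]
        push_cast
        field_simp
      · simp only [hkj, if_false]
        push_cast
        field_simp
        ring
    have h2 := hc1 _ h1
    rw [ha] at h2
    obtain ⟨m, hm⟩ := Complex.exp_eq_one_iff.mp h2
    refine ⟨m, ?_⟩
    have hpi : (Real.pi : ℂ) ≠ 0 := by exact_mod_cast Real.pi_ne_zero
    have hNc : (N : ℂ) ≠ 0 := by exact_mod_cast hN.ne'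
    push_cast at hm
    field_simp
    have : (2 * Real.pi : ℂ) * (a j * N) = (2 * Real.pi : ℂ) * (Complex.I * m) := by
      linear_combination hm
    exact mul_left_cancel₀ (mul_ne_zero two_ne_zero hpi) this
  choose m hm using hint
  refine ⟨m, fun φ => ?_⟩
  rw [hc, hsum]
  congr 2
  push_cast
  rw [Finset.sum_div, Finset.mul_sum]
  refine Finset.sum_congr rfl fun j _ => ?_
  rw [hm]; ring

theorem exists_isWeightBasis {N : ℕ} (hN : 0 < N) (R : CRep (SU N)) :
    ∃ b m, IsWeightBasis R b m := by
  set s := {v : Fin R.dim → ℂ | v ≠ 0 ∧ ∀ q, ∃ c : ℂ, R.rep (ratTorus q) v = c • v} with hs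
  set B := Module.Basis.ofSpan (span_common_eigenvectors hN R).ge with hB
  have hBs : ∀ i, B i ∈ s := fun i =>
    Module.Basis.ofSpan_subset (span_common_eigenvectors hN R).ge ⟨i, rfl⟩
  have : Fintype _ := FiniteDimensional.fintypeBasisIndex B
  have hcard := Module.finrank_eq_card_basis B
  rw [Module.finrank_fin_fun] at hcard
  set e := (Fintype.equivFinOfCardEq hcard.symm) with he
  choose m hm using fun i => exists_weight hN R (hBs (e.symm i)).1 (hBs (e.symm i)).2
  refine ⟨B.reindex e, m, fun i φ => ?_⟩
  rw [Module.Basis.reindex_apply]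
  exact hm i φ

/-! ### Integrality constraints on the weights -/

lemma IsWeightBasis.exp_eq_one {N : ℕ} {R : CRep (SU N)} {b m} (h : IsWeightBasis R b m)
    {φ : Fin N → ℝ} (hφ : torus φ = 1) (i) :
    Complex.exp (Complex.I * (((∑ j, m i j * φ j) / N : ℝ) : ℂ)) = 1 := by
  have h1 := h i φ
  rw [hφ, map_one, Module.End.one_apply] at h1
  exact (smul_left_injective ℂ (b.ne_zero i) (by simpa using h1)).symm

lemma IsWeightBasis.exists_int {N : ℕ} {R : CRep (SU N)} {b m} (h : IsWeightBasis R b m)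
    {φ : Fin N → ℝ} (hφ : torus φ = 1) (i) :
    ∃ n : ℤ, (∑ j, m i j * φ j) / N = 2 * Real.pi * n := by
  obtain ⟨n, hn⟩ := Complex.exp_eq_one_iff.mp (h.exp_eq_one hφ i)
  refine ⟨n, ?_⟩
  have : Complex.I * (((∑ j, m i j * φ j) / N : ℝ) : ℂ) =
      Complex.I * ((2 * Real.pi * n : ℝ) : ℂ) := by
    rw [hn]; push_cast; ring
  exact_mod_cast mul_left_cancel₀ Complex.I_ne_zero this

lemma IsWeightBasis.sum_eq_zero {N : ℕ} (hN : 0 < N) {R : CRep (SU N)} {b m}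
    (h : IsWeightBasis R b m) (i) : ∑ j, m i j = 0 := by
  by_contra hK
  have hK' : (∑ j, (m i j : ℝ)) ≠ 0 := by exact_mod_cast hK
  have hN' : (N : ℝ) ≠ 0 := by positivity
  -- Constant phases are centered to zero; this constant is chosen so that the weight takes the
  -- value π on it, which is not in 2πℤ.
  have hφ : torus (fun _ : Fin N => Real.pi * N / ∑ j, (m i j : ℝ)) = 1 := by
    refine torus_eq_one (fun _ => 0) fun j => ?_
    simp only [centered, Finset.sum_const, Finset.card_univ, Fintype.card_fin, nsmul_eq_mul]
    field_simp
    simp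
  obtain ⟨n, hn⟩ := h.exists_int hφ i
  rw [← Finset.sum_mul] at hn
  have h1 : Real.pi * 1 = Real.pi * (2 * n) := by
    rw [← mul_assoc, mul_comm Real.pi 2, ← hn]
    field_simp
  have h2 := mul_left_cancel₀ Real.pi_ne_zero h1
  have h3 : (1 : ℤ) = 2 * n := by exact_mod_cast h2
  omega

/-- The coroot phases 2π(e_j - e_k) give the identity, and the weight takes the value 2π(m_j -
m_k)/N there. -/
lemma IsWeightBasis.dvd_sub {N : ℕ} (hN : 0 < N) {R : CRep (SU N)} {b m}
    (h : IsWeightBasis R b m) (i j k) : (N : ℤ) ∣ m i j - m i k := by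
  have hN' : (N : ℝ) ≠ 0 := by positivity
  have hφ : torus ((2 * Real.pi) • (Pi.single j 1 - Pi.single k 1) : Fin N → ℝ) = 1 := by
    refine torus_eq_one (fun l => (if l = j then 1 else 0) - (if l = k then 1 else 0)) fun l => ?_
    rw [centered_smul, centered_of_sum_eq_zero (by simp [Finset.sum_sub_distrib])]
    simp [Pi.single_apply]
  obtain ⟨n, hn⟩ := h.exists_int hφ i
  refine ⟨n, ?_⟩
  have h1 : ∑ l, (m i l : ℝ) * ((2 * Real.pi) • (Pi.single j 1 - Pi.single k 1) : Fin N → ℝ) l =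
      2 * Real.pi * (m i j - m i k) := by
    simp only [Pi.smul_apply, Pi.sub_apply, smul_eq_mul, Pi.single_apply, mul_sub,
      Finset.sum_sub_distrib, mul_ite, mul_one, mul_zero, Finset.sum_ite_eq', Finset.mem_univ,
      if_true]
    ring
  rw [h1] at hn
  have hpi : (2 * Real.pi) ≠ 0 := by positivity
  have h2 : ((m i j : ℝ) - m i k) = N * n := by
    field_simp at hn
    linarith
  exact_mod_cast h2

/-- The torus contains the generator `exp (-2πi/N)` of the center of `SU(N)`. -/
lemma coe_torus_single {N : ℕ} (hN : 0 < N) (j : Fin N) :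
    (torus (Pi.single j (2 * Real.pi)) : Matrix (Fin N) (Fin N) ℂ) =
      Complex.exp (-(2 * Real.pi * Complex.I / N)) • (1 : Matrix (Fin N) (Fin N) ℂ) := by
  have hN' : (N : ℂ) ≠ 0 := by exact_mod_cast hN.ne'
  rw [coe_torus, ← Matrix.diagonal_one, ← Matrix.diagonal_smul]
  congr 1
  funext k
  simp only [Pi.smul_apply, smul_eq_mul, mul_one]
  rw [Complex.exp_eq_exp_iff_exists_int]
  refine ⟨if k = j then 1 else 0, ?_⟩
  simp only [centered, Pi.single_apply, Finset.sum_ite_eq', Finset.mem_univ, if_true]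
  split_ifs <;> (push_cast; field_simp; ring)

/-! ## The Casimir invariant from the weights -/

/-- In the weight basis, transported by u, the curve R(exp tX) is a finite sum of exponentials, so
it can be differentiated term by term; smoothness of R need not be known beforehand. -/
lemma lie_eq_toMatrix {N : ℕ} {R : CRep (SU N)} {b : Module.Basis (Fin R.dim) ℂ (Fin R.dim → ℂ)}
    {m} (h : IsWeightBasis R b m) (X : su N) (u : SU N) (θ : Fin N → ℝ) (hθ : ∑ j, θ j = 0)
    (hX : (X : Matrix (Fin N) (Fin N) ℂ) = (u : Matrix (Fin N) (Fin N) ℂ) *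
      Matrix.diagonal (fun j => Complex.I * θ j) * star (u : Matrix (Fin N) (Fin N) ℂ)) :
    R.lie X = LinearMap.toMatrix' (R.rep u ∘ₗ
      (b.constr ℂ fun i => (Complex.I * (((∑ j, m i j * θ j) / N : ℝ) : ℂ)) • b i) ∘ₗ R.rep u⁻¹) := by
  ext k l
  rw [LinearMap.toMatrix'_apply]
  simp only [CRep.lie, Matrix.of_apply]
  apply HasDerivAt.deriv
  set ω : Fin R.dim → ℝ := fun i => (∑ j, m i j * θ j) / N with hω
  set w := R.rep u⁻¹ (Pi.single l 1) with hw
  have hcurve : ∀ t : ℝ, R.rep (oneParam X t) (Pi.single l 1) k =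
      ∑ i, b.repr w i * Complex.exp (Complex.I * ω i * t) * R.rep u (b i) k := by
    intro t
    rw [oneParam_eq_conj_torus X u θ hθ hX, map_mul, map_mul, Module.End.mul_apply,
      Module.End.mul_apply, ← hw]
    conv_lhs => rw [← b.sum_repr w]
    simp only [map_sum, map_smul, Finset.sum_apply, Pi.smul_apply, smul_eq_mul]
    refine Finset.sum_congr rfl fun i _ => ?_
    rw [h i, map_smul, Pi.smul_apply, smul_eq_mul, mul_assoc]
    congr 3
    simp only [hω, Pi.smul_apply, smul_eq_mul]
    push_cast
    rw [Finset.sum_congr rfl fun j _ => show (m i j : ℂ) * (t * θ j) = t * (m i j * θ j) by ring,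
      ← Finset.mul_sum]
    ring
  have hval : (R.rep u ∘ₗ (b.constr ℂ fun i => (Complex.I * (ω i : ℂ)) • b i) ∘ₗ R.rep u⁻¹)
      (Pi.single l 1) k = ∑ i, b.repr w i * (Complex.I * ω i) * R.rep u (b i) k := by
    rw [LinearMap.comp_apply, LinearMap.comp_apply, ← hw, Module.Basis.constr_apply_fintype]
    simp only [map_sum, map_smul, Finset.sum_apply, Pi.smul_apply, smul_eq_mul,
      Module.Basis.equivFun_apply]
    exact Finset.sum_congr rfl fun i _ => by ring
  rw [hval]
  simp only [hcurve]
  refine HasDerivAt.fun_sum fun i _ => ?_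
  have h1 : HasDerivAt (fun t : ℝ => Complex.exp (Complex.I * ω i * (t : ℂ)))
      (Complex.exp (Complex.I * ω i * ((0 : ℝ) : ℂ)) * (Complex.I * ω i * 1)) 0 :=
    ((Complex.ofRealCLM.hasDerivAt (x := (0 : ℝ))).const_mul _).cexp
  refine ((h1.const_mul (b.repr w i)).mul_const (R.rep u (b i) k)).congr_deriv ?_
  simp

lemma trace_lie_sq {N : ℕ} {R : CRep (SU N)} {b : Module.Basis (Fin R.dim) ℂ (Fin R.dim → ℂ)}
    {m} (h : IsWeightBasis R b m) (X : su N) (u : SU N) (θ : Fin N → ℝ) (hθ : ∑ j, θ j = 0)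
    (hX : (X : Matrix (Fin N) (Fin N) ℂ) = (u : Matrix (Fin N) (Fin N) ℂ) *
      Matrix.diagonal (fun j => Complex.I * θ j) * star (u : Matrix (Fin N) (Fin N) ℂ)) :
    (R.lie X * R.lie X).trace = -((∑ i, ((∑ j, m i j * θ j) / N) ^ 2 : ℝ) : ℂ) := by
  rw [lie_eq_toMatrix h X u θ hθ hX, ← LinearMap.toMatrix'_comp]
  set L := b.constr ℂ fun i => (Complex.I * (((∑ j, m i j * θ j) / N : ℝ) : ℂ)) • b i with hL
  have hinv : R.rep u⁻¹ ∘ₗ R.rep u = LinearMap.id := by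
    rw [← Module.End.mul_eq_comp, ← map_mul, inv_mul_cancel, map_one]; rfl
  have h1 : (R.rep u ∘ₗ L ∘ₗ R.rep u⁻¹) ∘ₗ (R.rep u ∘ₗ L ∘ₗ R.rep u⁻¹) =
      R.rep u ∘ₗ (L ∘ₗ L ∘ₗ R.rep u⁻¹) := by
    ext1 v
    ext1
    have := fun v => LinearMap.congr_fun hinv v
    simp only [LinearMap.comp_apply, LinearMap.id_apply] at this ⊢
    rw [this]
  rw [h1, ← LinearMap.toMatrix_eq_toMatrix', ← LinearMap.trace_eq_matrix_trace, LinearMap.trace_comp_comm',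
    LinearMap.comp_assoc, LinearMap.comp_assoc, hinv, LinearMap.comp_id,
    LinearMap.trace_eq_matrix_trace ℂ b, Matrix.trace]
  push_cast
  rw [← Finset.sum_neg_distrib]
  refine Finset.sum_congr rfl fun i _ => ?_
  rw [Matrix.diag_apply, LinearMap.toMatrix_apply, LinearMap.comp_apply, hL,
    Module.Basis.constr_basis, map_smul, Module.Basis.constr_basis]
  simp only [map_smul, Module.Basis.repr_self, Finsupp.smul_apply, Finsupp.single_eq_same,
    smul_eq_mul, mul_one]
  push_cast
  linear_combination ((∑ j, (m i j : ℂ) * θ j) / N) ^ 2 * Complex.I_sq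

/-- The eigenvalues (divided by `i`) of the elements of `frame`. -/
def frameEigen (N : ℕ) (p : Fin N × Fin N) : Fin N → ℝ :=
  if p.1 = p.2 then Pi.single p.1 1 - fun _ => (N : ℝ)⁻¹
  else (Real.sqrt 2)⁻¹ • (Pi.single p.1 1 - Pi.single p.2 1)

lemma sum_frameEigen {N : ℕ} (p : Fin N × Fin N) : ∑ j, frameEigen N p j = 0 := by
  have hN : (N : ℝ) ≠ 0 := by
    have : 0 < N := lt_of_le_of_lt (Nat.zero_le _) p.1.2
    positivity
  unfold frameEigen
  split_ifs
  · simp [Finset.sum_sub_distrib, hN]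
  · simp [← Finset.mul_sum, Finset.sum_sub_distrib]

/-- The rotation by 45 degrees in the plane of two coordinates, with phase `α`. -/
lemma exists_unitary_rotation {N : ℕ} {j k : Fin N} (hjk : j ≠ k) {α : ℂ} (hα : α * star α = 1) :
    ∃ V : Matrix.unitaryGroup (Fin N) ℂ, (V : Matrix (Fin N) (Fin N) ℂ) *
      (Matrix.single j j 1 - Matrix.single k k 1) * star (V : Matrix (Fin N) (Fin N) ℂ) =
      star α • Matrix.single j k 1 + α • Matrix.single k j (1 : ℂ) := by
  obtain ⟨r, hr, hrs⟩ : ∃ r : ℂ, r * r = 1 / 2 ∧ star r = r := by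
    refine ⟨((Real.sqrt 2 : ℝ) : ℂ)⁻¹, ?_, by simp⟩
    rw [← mul_inv, ← Complex.ofReal_mul, Real.mul_self_sqrt (by norm_num)]; norm_num
  -- With r = 1/√2, the columns of V in the (j, k) plane are (r, rα) and (-r ᾱ, r), the eigenvectors
  -- of the target matrix for 1 and -1.
  set V : Matrix (Fin N) (Fin N) ℂ := 1 + (r - 1) • Matrix.single j j 1 +
    (r - 1) • Matrix.single k k 1 + (r * α) • Matrix.single k j 1 -
    (r * star α) • Matrix.single j k 1 with hV
  have hVs : star V = 1 + (r - 1) • Matrix.single j j 1 +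
    (r - 1) • Matrix.single k k 1 - (r * α) • Matrix.single k j 1 +
    (r * star α) • Matrix.single j k 1 := by
    simp only [hV, star_add, star_sub, star_smul, star_one, star_mul', star_star, hrs,
      Matrix.star_eq_conjTranspose, Matrix.conjTranspose_single]
    module
  have hne : ∀ i l : Fin N, Matrix.single i j (1 : ℂ) * Matrix.single k l 1 = 0 :=
    fun i l => Matrix.single_mul_single_of_ne _ _ _ _ hjk _
  have hne' : ∀ i l : Fin N, Matrix.single i k (1 : ℂ) * Matrix.single j l 1 = 0 :=
    fun i l => Matrix.single_mul_single_of_ne _ _ _ _ hjk.symm _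
  refine ⟨⟨V, ?_⟩, ?_⟩
  · rw [Matrix.mem_unitaryGroup_iff, hVs, hV]
    simp only [mul_add, mul_sub, add_mul, sub_mul, smul_mul_assoc, mul_smul_comm, one_mul, mul_one,
      Matrix.single_mul_single_same, hne, hne', smul_zero]
    match_scalars <;> grind
  · change V * _ * star V = _
    rw [hVs, hV]
    simp only [mul_add, mul_sub, add_mul, sub_mul, smul_mul_assoc, mul_smul_comm, one_mul, mul_one,
      Matrix.single_mul_single_same, hne, hne', smul_zero, sub_zero,
      zero_sub, add_zero]
    match_scalars <;> grind

lemma diagonal_single_sub_single {N : ℕ} (j k : Fin N) (c : ℝ) :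
    Matrix.diagonal (fun l => Complex.I * (((c • (Pi.single j 1 - Pi.single k 1) : Fin N → ℝ) l : ℝ) : ℂ)) =
      (Complex.I * c) • (Matrix.single j j 1 - Matrix.single k k 1) := by
  ext a b
  rcases eq_or_ne a b with rfl | hab
  · simp only [Matrix.diagonal_apply_eq, Matrix.smul_apply, Matrix.sub_apply, Pi.smul_apply,
      Pi.sub_apply, smul_eq_mul, Pi.single_apply, Matrix.single_apply, and_self, eq_comm (a := a)]
    split_ifs <;> (push_cast; ring)
  · have h1 : ∀ l : Fin N, ¬ (l = a ∧ l = b) := fun l hl => hab (hl.1.symm.trans hl.2)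
    simp [hab, h1]

/-- Off the diagonal, a frame element is i/√2 times ᾱ E_jk + α E_kj, with α = i for j < k and α = 1
for k < j, and the rotation above diagonalizes it. The others are diagonal already. -/
lemma exists_frame_conj {N : ℕ} (p : Fin N × Fin N) : ∃ u : SU N,
    (frame N p : Matrix (Fin N) (Fin N) ℂ) = (u : Matrix (Fin N) (Fin N) ℂ) *
      Matrix.diagonal (fun j => Complex.I * frameEigen N p j) *
        star (u : Matrix (Fin N) (Fin N) ℂ) := by
  have hN : 0 < N := lt_of_le_of_lt (Nat.zero_le _) p.1.2
  obtain ⟨j, k⟩ := p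
  change ∃ u : SU N, frameMatrix N (j, k) = _
  have hoff : ∀ α : ℂ, α * star α = 1 → j ≠ k → frameMatrix N (j, k) =
      (Complex.I * ((Real.sqrt 2 : ℝ) : ℂ)⁻¹) •
        (star α • Matrix.single j k 1 + α • Matrix.single k j (1 : ℂ)) →
      ∃ u : SU N, frameMatrix N (j, k) = (u : Matrix (Fin N) (Fin N) ℂ) *
        Matrix.diagonal (fun l => Complex.I * frameEigen N (j, k) l) *
          star (u : Matrix (Fin N) (Fin N) ℂ) := by
    intro α hα hjk hF
    obtain ⟨V, hV⟩ := exists_unitary_rotation hjk hα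
    obtain ⟨u, hu⟩ := exists_SU_conj hN V
    refine ⟨u, ?_⟩
    simp only [hu, frameEigen, if_neg hjk]
    rw [diagonal_single_sub_single, Matrix.mul_smul, Matrix.smul_mul, hV, hF]
    push_cast
    rfl
  rcases lt_trichotomy j k with h | rfl | h
  · refine hoff Complex.I (by simp) h.ne ?_
    simp only [frameMatrix, h, if_true, Complex.star_def, Complex.conj_I]
    match_scalars <;> grind [Complex.I_sq]
  · refine ⟨1, ?_⟩
    simp only [frameMatrix, lt_irrefl, if_false, frameEigen, if_true, OneMemClass.coe_one, star_one,
      one_mul, mul_one]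
    ext a b
    rcases eq_or_ne a b with rfl | hab
    · simp only [Matrix.smul_apply, Matrix.sub_apply, Matrix.single_apply, and_self,
        Matrix.one_apply_eq, smul_eq_mul, mul_one, Matrix.diagonal_apply_eq, Pi.sub_apply,
        Pi.single_apply, eq_comm (a := a)]
      split_ifs <;> simp
    · have h1 : ∀ l : Fin N, ¬ (l = a ∧ l = b) := fun l hl => hab (hl.1.symm.trans hl.2)
      simp [hab, h1]
  · refine hoff 1 (by simp) h.ne' ?_
    simp only [frameMatrix, h, h.not_gt, if_true, if_false, star_one, one_smul]

/-- Ordered pairs j ≠ k contribute ½ ∑ (x_j - x_k)² = N ∑ x_j² because ∑ x_j = 0; the diagonal pairs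
contribute one more ∑ x_j². -/
lemma sum_frameEigen_sq {N : ℕ} (x : Fin N → ℝ) (hx : ∑ j, x j = 0) :
    ∑ p, (∑ j, x j * frameEigen N p j) ^ 2 = (N + 1) * ∑ j, x j ^ 2 := by
  have h2 : (Real.sqrt 2)⁻¹ ^ 2 = 1 / 2 := by
    rw [inv_pow, Real.sq_sqrt (by norm_num)]; norm_num
  have hp : ∀ p : Fin N × Fin N, (∑ j, x j * frameEigen N p j) ^ 2 =
      (x p.1 - x p.2) ^ 2 / 2 + if p.1 = p.2 then x p.1 ^ 2 else 0 := by
    rintro ⟨j, k⟩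
    simp only [frameEigen]
    split_ifs with hjk
    · subst hjk
      simp only [Pi.sub_apply, mul_sub, Finset.sum_sub_distrib, Pi.single_apply, mul_ite, mul_one,
        mul_zero, Finset.sum_ite_eq', Finset.mem_univ, if_true, ← Finset.sum_mul, hx]
      ring
    · simp only [Pi.smul_apply, smul_eq_mul, Pi.sub_apply, mul_sub, Finset.sum_sub_distrib,
        Pi.single_apply, mul_ite, mul_one, mul_zero, Finset.sum_ite_eq', Finset.mem_univ, if_true]
      linear_combination (x j - x k) ^ 2 * h2
  simp only [hp, Finset.sum_add_distrib, Fintype.sum_prod_type, Finset.sum_ite_eq, Finset.mem_univ,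
    if_true, ← Finset.sum_div, sub_sq, Finset.sum_sub_distrib, Finset.sum_const, Finset.card_univ,
    Fintype.card_fin, nsmul_eq_mul, mul_assoc, ← Finset.mul_sum, hx, mul_zero]
  ring

/-- The trace of the Casimir operator sees every weight equally, which yields N + 1 times the mean
squared length of the vectors m/N. -/
theorem IsWeightBasis.casimir_eq {N : ℕ} (hN : 0 < N) {R : CRep (SU N)} {b m}
    (h : IsWeightBasis R b m) :
    R.casimir = (N + 1) / (N ^ 2 * R.dim) * ((∑ i, ∑ j, m i j ^ 2 : ℤ) : ℝ) := by
  have hN' : (N : ℝ) ≠ 0 := by positivity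
  have h1 : R.casimirOperator.trace =
      ((∑ p, ∑ i, ((∑ j, m i j * frameEigen N p j) / N) ^ 2 : ℝ) : ℂ) := by
    rw [CRep.casimirOperator, Matrix.trace_neg, Matrix.trace_sum]
    push_cast
    rw [← Finset.sum_neg_distrib]
    refine Finset.sum_congr rfl fun p _ => ?_
    obtain ⟨u, hu⟩ := exists_frame_conj p
    rw [trace_lie_sq h _ u _ (sum_frameEigen p) hu]
    push_cast
    ring
  have h2 : ∑ p, ∑ i, ((∑ j, m i j * frameEigen N p j) / N) ^ 2 =
      (N + 1) / N ^ 2 * ((∑ i, ∑ j, m i j ^ 2 : ℤ) : ℝ) := by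
    rw [Finset.sum_comm]
    push_cast
    rw [Finset.mul_sum]
    refine Finset.sum_congr rfl fun i _ => ?_
    simp only [div_pow, ← Finset.sum_div]
    rw [sum_frameEigen_sq _ (by exact_mod_cast h.sum_eq_zero hN i)]
    ring
  rw [CRep.casimir, h1, h2, ← Complex.ofReal_natCast, ← Complex.ofReal_div, Complex.ofReal_re]
  rw [div_mul_eq_mul_div, div_mul_eq_mul_div, div_div]

/-! ## The norm of weights of non-zero `N`-ality -/

lemma exists_eq_single_of_sum_eq_one {N : ℕ} {x : Fin N → ℤ} (hx : ∀ j, x j = 0 ∨ x j = 1)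
    (hs : ∑ j, x j = 1) : ∃ i, x = Pi.single i 1 := by
  obtain ⟨i, hi⟩ : ∃ i, x i ≠ 0 := by
    by_contra! h
    simp [h] at hs
  have hi1 : x i = 1 := (hx i).resolve_left hi
  refine ⟨i, funext fun j => ?_⟩
  rcases eq_or_ne j i with rfl | hji
  · simp [hi1]
  · rw [Pi.single_eq_of_ne hji]
    rw [← Finset.add_sum_erase _ _ (Finset.mem_univ i), hi1] at hs
    have h0 : ∑ k ∈ Finset.univ.erase i, x k = 0 := by linarith
    rw [Finset.sum_eq_zero_iff_of_nonneg fun k _ => by rcases hx k with h | h <;> simp [h]] at h0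
    exact h0 j (by simp [hji])

/-- Write m = r + N n, so that ∑ n = -r and |m|² = N² ∑ n² - N r². Integrality gives n² + n ≥ 0,
hence ∑ n² ≥ r, with equality only for entries 0 and -1. -/
lemma weight_norm_bound {N : ℕ} {m : Fin N → ℤ} (hm : ∑ j, m j = 0) {r : ℤ} (hr : 0 < r)
    (hrN : r < N) (hd : ∀ j, (N : ℤ) ∣ m j - r) :
    (N : ℤ) * (N - 1) ≤ ∑ j, m j ^ 2 ∧ (∑ j, m j ^ 2 = (N : ℤ) * (N - 1) →
      (r = N - 1 ∧ ∃ i, m = fun j => (N : ℤ) * (Pi.single i 1 : Fin N → ℤ) j - 1) ∨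
      (r = 1 ∧ ∃ i, m = fun j => 1 - (N : ℤ) * (Pi.single i 1 : Fin N → ℤ) j)) := by
  have hN : (0 : ℤ) < N := hr.trans hrN
  choose n hn using hd
  have hmn : ∀ j, m j = r + N * n j := fun j => by linarith [hn j]
  have hsn : ∑ j, n j = -r := by
    have h1 : ∑ j, m j = N * (r + ∑ j, n j) := by
      simp only [hmn, Finset.sum_add_distrib, Finset.sum_const, Finset.card_univ, Fintype.card_fin,
        nsmul_eq_mul, ← Finset.mul_sum]
      ring
    rw [hm] at h1
    have := (mul_eq_zero.mp h1.symm).resolve_left hN.ne'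
    linarith
  have hsq : ∑ j, m j ^ 2 = N ^ 2 * ∑ j, n j ^ 2 - N * r ^ 2 := by
    have h1 : ∀ j, m j ^ 2 = r ^ 2 + 2 * r * N * n j + N ^ 2 * n j ^ 2 := fun j => by
      rw [hmn]; ring
    simp only [h1, Finset.sum_add_distrib, Finset.sum_const, Finset.card_univ, Fintype.card_fin,
      nsmul_eq_mul, ← Finset.mul_sum, hsn]
    ring
  have hpt : ∀ j, 0 ≤ n j ^ 2 + n j := fun j => by
    rcases le_or_gt 0 (n j) with h | h <;> nlinarith
  have hsum : ∑ j, (n j ^ 2 + n j) = ∑ j, n j ^ 2 - r := by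
    rw [Finset.sum_add_distrib, hsn]; ring
  have hge : r ≤ ∑ j, n j ^ 2 := by
    have := Finset.sum_nonneg fun j (_ : j ∈ Finset.univ) => hpt j
    linarith
  have hrr : 0 ≤ (r - 1) * (N - 1 - r) := mul_nonneg (by linarith) (by linarith)
  -- The excess over the minimum is a sum of two non-negative terms, so equality kills both: one
  -- fixes n, the other r.
  have e1 : ∑ j, m j ^ 2 - N * (N - 1) =
      N ^ 2 * (∑ j, n j ^ 2 - r) + N * ((r - 1) * (N - 1 - r)) := by
    rw [hsq]; ring
  have t1 : 0 ≤ (N : ℤ) ^ 2 * (∑ j, n j ^ 2 - r) := mul_nonneg (by positivity) (by linarith)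
  have t2 : 0 ≤ (N : ℤ) * ((r - 1) * (N - 1 - r)) := mul_nonneg hN.le hrr
  refine ⟨by linarith, fun heq => ?_⟩
  have z1 : (N : ℤ) ^ 2 * (∑ j, n j ^ 2 - r) = 0 := by linarith
  have z2 : (N : ℤ) * ((r - 1) * (N - 1 - r)) = 0 := by linarith
  have w1 := (mul_eq_zero.mp z1).resolve_left (by positivity)
  have w2 := mul_eq_zero.mp ((mul_eq_zero.mp z2).resolve_left hN.ne')
  rw [← hsum, Finset.sum_eq_zero_iff_of_nonneg fun j _ => hpt j] at w1
  have hn01 : ∀ j, n j = 0 ∨ n j = -1 := fun j => by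
    have h1 : n j * (n j + 1) = 0 := by linarith [w1 j (Finset.mem_univ j)]
    rcases mul_eq_zero.mp h1 with h | h
    · exact Or.inl h
    · exact Or.inr (by linarith)
  rcases w2 with h | h
  · refine Or.inr ⟨by linarith, ?_⟩
    obtain ⟨i, hi⟩ := exists_eq_single_of_sum_eq_one (x := fun j => -n j)
      (fun j => by rcases hn01 j with h | h <;> simp [h])
      (by rw [Finset.sum_neg_distrib, hsn]; linarith)
    refine ⟨i, funext fun j => ?_⟩
    have := congrFun hi j
    rw [hmn, ← this]
    linarith
  · refine Or.inl ⟨by linarith, ?_⟩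
    obtain ⟨i, hi⟩ := exists_eq_single_of_sum_eq_one (x := fun j => n j + 1)
      (fun j => by rcases hn01 j with h | h <;> simp [h])
      (by rw [Finset.sum_add_distrib, hsn]; simp; linarith)
    refine ⟨i, funext fun j => ?_⟩
    have := congrFun hi j
    rw [hmn, ← this]
    linarith

/-! ## The action of the center -/

/-- **Schur's lemma** for central elements. -/
lemma exists_scalar_of_central {G V : Type*} [Group G] [AddCommGroup V] [Module ℂ V]
    [FiniteDimensional ℂ V] (ρ : Representation ℂ G V) [ρ.IsIrreducible] {z : G}
    (hz : ∀ g, g * z = z * g) : ∃ c : ℂ, ∀ v, ρ z v = c • v := by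
  have hz' : z ∈ Submonoid.center G := Submonoid.mem_center_iff.mpr hz
  obtain ⟨c, hc⟩ :=
    (Representation.IsIrreducible.algebraMap_intertwiningMap_bijective_of_isAlgClosed
      (ρ := ρ)).2 (Representation.IntertwiningMap.centralMul ρ z hz')
  refine ⟨c, fun v => ?_⟩
  have := congrArg (fun f : Representation.IntertwiningMap ρ ρ => f v) hc
  exact this.symm

lemma CRep.nonempty_fin_dim {G : Type} [Group G] [TopologicalSpace G] (R : CRep G)
    [R.rep.IsIrreducible] : Nonempty (Fin R.dim) := by
  by_contra h
  rw [not_nonempty_iff] at h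
  have : Subsingleton (Subrepresentation R.rep) :=
    ⟨fun a b => by
      ext x
      have : x = 0 := Subsingleton.elim _ _
      subst this
      exact iff_of_true a.toSubmodule.zero_mem b.toSubmodule.zero_mem⟩
  exact not_subsingleton (Subrepresentation R.rep) this

lemma torus_single_central {N : ℕ} (hN : 0 < N) (j : Fin N) (g : SU N) :
    g * torus (Pi.single j (2 * Real.pi)) = torus (Pi.single j (2 * Real.pi)) * g := by
  apply Subtype.ext
  rw [Submonoid.coe_mul, Submonoid.coe_mul, coe_torus_single hN]
  simp

/-- All weights of an irreducible representation have the same `N`-ality. -/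
lemma IsWeightBasis.dvd_sub_of_isIrreducible {N : ℕ} (hN : 0 < N) {R : CRep (SU N)} {b m}
    (h : IsWeightBasis R b m) [R.rep.IsIrreducible] (i i' j) : (N : ℤ) ∣ m i j - m i' j := by
  -- This central element acts on the i-th weight vector by exp (2πi m_ij / N), and by Schur the
  -- scalar does not depend on i.
  obtain ⟨c, hc⟩ := exists_scalar_of_central R.rep (torus_single_central hN j)
  have key : ∀ i, c = Complex.exp (Complex.I * ((m i j * (2 * Real.pi) / N : ℝ) : ℂ)) := by
    intro i
    have h1 := h i (Pi.single j (2 * Real.pi))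
    rw [hc] at h1
    have h2 := smul_left_injective ℂ (b.ne_zero i) h1
    rw [h2]
    simp [Pi.single_apply]
  have h1 := (key i).symm.trans (key i')
  obtain ⟨n, hn⟩ := Complex.exp_eq_exp_iff_exists_int.mp h1
  refine ⟨n, ?_⟩
  have hNc : (N : ℂ) ≠ 0 := by exact_mod_cast hN.ne'
  have hpi : (2 * Real.pi * Complex.I : ℂ) ≠ 0 := by
    simp [Real.pi_ne_zero]
  have h2 : (2 * Real.pi * Complex.I : ℂ) * (m i j - m i' j) = (2 * Real.pi * Complex.I) * (N * n) := by
    push_cast at hn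
    field_simp at hn
    linear_combination Complex.I * 2 * Real.pi * hn
  have h3 := mul_left_cancel₀ hpi h2
  exact_mod_cast h3

/-- The element `-1` of `SO(N)` for `N` even. -/
def negSO {N : ℕ} (hN : Even N) : SO N :=
  ⟨-1, by
    rw [Matrix.mem_specialUnitaryGroup_iff, Matrix.mem_unitaryGroup_iff, Matrix.det_neg]
    simp [hN.neg_one_pow]⟩

/-- The centered phases are (N - 1)π at j and -π elsewhere, all odd multiples of π for even N. This
form allows weights to be evaluated at -1. -/
lemma inclSO_negSO {N : ℕ} (hN : Even N) (j : Fin N) :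
    inclSO N (negSO hN) = torus (Pi.single j (N * Real.pi)) := by
  apply Subtype.ext
  change (-1 : Matrix (Fin N) (Fin N) ℝ).map Complex.ofRealHom = _
  have hN' : (N : ℂ) ≠ 0 := by
    have : 0 < N := lt_of_le_of_lt (Nat.zero_le _) j.2
    exact_mod_cast this.ne'
  have h1 : (-1 : Matrix (Fin N) (Fin N) ℝ).map Complex.ofRealHom =
      Matrix.diagonal fun _ => (-1 : ℂ) := by
    ext a b
    rcases eq_or_ne a b with rfl | hab
    · simp
    · simp [hab]
  rw [h1, coe_torus]
  congr 1
  funext k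
  rw [← Complex.exp_pi_mul_I, Complex.exp_eq_exp_iff_exists_int]
  obtain ⟨l, hl⟩ := hN
  have hl' : (N : ℂ) = l + l := by exact_mod_cast hl
  refine ⟨if k = j then 1 - l else 1, ?_⟩
  simp only [centered, Pi.single_apply, Finset.sum_ite_eq', Finset.mem_univ, if_true]
  split_ifs
  · push_cast
    rw [mul_div_cancel_left₀ _ hN', hl']
    ring
  · push_cast
    rw [mul_div_cancel_left₀ _ hN']
    ring

/-! ### Haar measure on SO(N) and the parity selection rule -/

instance isProbabilityMeasure_haarSO (N : ℕ) : IsProbabilityMeasure (haarSO N) where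
  measure_univ := Measure.haarMeasure_self (K₀ := ⊤)

instance isHaarMeasure_haarSO (N : ℕ) : (haarSO N).IsHaarMeasure :=
  Measure.isHaarMeasure_haarMeasure _

lemma character_fundamental {N : ℕ} (U : SU N) :
    (fundamental N).rep.character U = (U : Matrix (Fin N) (Fin N) ℂ).trace := by
  change LinearMap.trace ℂ (Fin N → ℂ) (Matrix.toLin' (U : Matrix (Fin N) (Fin N) ℂ)) = _
  rw [Matrix.trace_toLin'_eq]

lemma character_vectorRep {N : ℕ} (u : SO N) :
    (vectorRep N).rep.character u = ((u : Matrix (Fin N) (Fin N) ℝ).trace : ℂ) := by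
  change (fundamental N).rep.character (inclSO N u) = _
  rw [character_fundamental]
  change ((u : Matrix (Fin N) (Fin N) ℝ).map Complex.ofRealHom).trace = _
  simp [Matrix.trace]

/-- On the surviving sectors `-1` acts as the scalar `-1`. -/
lemma Survives.rep_neg {N : ℕ} (hN : Even N) {g a : ℝ} {R : CRep (SU N)}
    (h : Survives (vectorRep N) g a R) (v) : R.rep (inclSO N (negSO hN)) v = -v := by
  obtain ⟨hirr, hW⟩ := h
  have hcen : ∀ U : SU N, U * inclSO N (negSO hN) = inclSO N (negSO hN) * U := by
    intro U
    apply Subtype.ext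
    have : ((inclSO N (negSO hN) : SU N) : Matrix (Fin N) (Fin N) ℂ) = -1 := by
      change (-1 : Matrix (Fin N) (Fin N) ℝ).map Complex.ofRealHom = _
      ext a b
      rcases eq_or_ne a b with rfl | hab
      · simp
      · simp [hab]
    rw [Submonoid.coe_mul, Submonoid.coe_mul, this]
    simp
  obtain ⟨c, hc⟩ := exists_scalar_of_central R.rep hcen
  have hrep : R.rep (inclSO N (negSO hN)) = c • 1 := by
    ext1 v
    ext1
    simp [hc]
  have hchar : ∀ u, R.rep.character (inclSO N (negSO hN * u)) = c * R.rep.character (inclSO N u) := by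
    intro u
    rw [map_mul]
    simp only [Representation.character, map_mul, hrep, smul_mul_assoc, one_mul, map_smul,
      smul_eq_mul]
  have hvec : ∀ u, (vectorRep N).rep.character (negSO hN * u) = -(vectorRep N).rep.character u := by
    intro u
    rw [character_vectorRep, character_vectorRep, Submonoid.coe_mul]
    simp [negSO]
  -- Substituting u ↦ -u in the Haar integral multiplies χ_κ by -1 and χ_R by c.
  have hWW : orbifoldWilson (vectorRep N) g a R = -c * orbifoldWilson (vectorRep N) g a R := by
    unfold orbifoldWilson
    conv_lhs => rw [← integral_mul_left_eq_self _ (negSO hN)]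
    rw [← integral_const_mul]
    congr 1
    funext u
    simp only [diskCorrelator, hchar, hvec]
    ring
  have hc1 : c = -1 := by
    have : (1 + c) * orbifoldWilson (vectorRep N) g a R = 0 := by linear_combination hWW
    have := (mul_eq_zero.mp this).resolve_right hW
    linear_combination this
  rw [hc, hc1, neg_one_smul]

lemma IsWeightBasis.odd_of_survives {N : ℕ} (hN : Even N) (hN0 : 0 < N) {g a : ℝ} {R : CRep (SU N)}
    {b m} (h : IsWeightBasis R b m) (hS : Survives (vectorRep N) g a R) (i j) : Odd (m i j) := by
  have h1 := hS.rep_neg hN (b i)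
  rw [inclSO_negSO hN j, h] at h1
  have h2 : Complex.exp (Complex.I * (((∑ k, m i k * (Pi.single j (N * Real.pi) : Fin N → ℝ) k) / N : ℝ) : ℂ)) = -1 :=
    smul_left_injective ℂ (b.ne_zero i) (by simpa using h1)
  have hN' : (N : ℝ) ≠ 0 := by positivity
  have h3 : (∑ k, m i k * (Pi.single j (N * Real.pi) : Fin N → ℝ) k) / N = m i j * Real.pi := by
    simp only [Pi.single_apply, mul_ite, mul_zero, Finset.sum_ite_eq', Finset.mem_univ, if_true]
    field_simp
  rw [h3] at h2
  by_contra hodd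
  rw [Int.not_odd_iff_even] at hodd
  obtain ⟨l, hl⟩ := hodd
  have h4 : Complex.exp (Complex.I * ((m i j * Real.pi : ℝ) : ℂ)) = 1 := by
    rw [Complex.exp_eq_one_iff]
    refine ⟨l, ?_⟩
    rw [hl]; push_cast; ring
  rw [h4] at h2
  norm_num at h2

/-- The common `N`-ality of the weights of a surviving sector is odd, hence non-zero. -/
lemma IsWeightBasis.exists_nality {N : ℕ} (hN : Even N) (hN0 : 0 < N) {g a : ℝ} {R : CRep (SU N)}
    {b m} (h : IsWeightBasis R b m) (hS : Survives (vectorRep N) g a R) :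
    ∃ r : ℤ, 0 < r ∧ r < N ∧ ∀ i j, (N : ℤ) ∣ m i j - r := by
  have := hS.1
  obtain ⟨i₀⟩ := R.nonempty_fin_dim
  let j₀ : Fin N := ⟨0, hN0⟩
  have hNZ : (0 : ℤ) < N := by exact_mod_cast hN0
  refine ⟨m i₀ j₀ % N, ?_, Int.emod_lt_of_pos _ hNZ, fun i j => ?_⟩
  -- Residue zero would make an entry divisible by the even number N, contrary to oddness.
  · refine lt_of_le_of_ne (Int.emod_nonneg _ hNZ.ne') fun h0 => ?_
    have h1 : (N : ℤ) ∣ m i₀ j₀ := Int.dvd_of_emod_eq_zero h0.symm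
    have h2 : (2 : ℤ) ∣ m i₀ j₀ := (by exact_mod_cast hN.two_dvd : (2 : ℤ) ∣ N).trans h1
    exact (Int.not_odd_iff_even.mpr (even_iff_two_dvd.mpr h2)) (h.odd_of_survives hN hN0 hS i₀ j₀)
  · have h1 := h.dvd_sub hN0 i j j₀
    have h2 := h.dvd_sub_of_isIrreducible hN0 i i₀ j₀
    have h3 : (N : ℤ) ∣ m i₀ j₀ - m i₀ j₀ % N := Int.dvd_self_sub_emod
    have e : m i j - m i₀ j₀ % N =
        (m i j - m i j₀) + (m i j₀ - m i₀ j₀) + (m i₀ j₀ - m i₀ j₀ % N) := by ring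
    rw [e]
    exact dvd_add (dvd_add h1 h2) h3

/-! ## Orthogonality of characters -/

lemma character_eq_sum {G : Type} [Group G] [TopologicalSpace G] (R : CRep G) (g : G) :
    R.rep.character g = ∑ k, R.rep g (Pi.single k 1) k := by
  rw [Representation.character, LinearMap.trace_eq_matrix_trace ℂ (Pi.basisFun ℂ _)]
  simp [Matrix.trace]

lemma CRep.continuous_rep_prod {G : Type} [Group G] [TopologicalSpace G] (R : CRep G)
    {X : Type*} [TopologicalSpace X] {f : X → G} (hf : Continuous f) {w : X → Fin R.dim → ℂ}
    (hw : Continuous w) : Continuous fun x => R.rep (f x) (w x) := by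
  have : (fun x => R.rep (f x) (w x)) = fun x => ∑ k, w x k • R.rep (f x) (Pi.single k 1) := by
    funext x
    conv_lhs => rw [pi_eq_sum_univ' (w x)]
    simp
  rw [this]
  exact continuous_finsetSum _ fun k _ =>
    ((continuous_apply k).comp hw).smul (R.continuous_rep_apply hf _)

section Averaging

variable {G : Type} [Group G] [TopologicalSpace G] [IsTopologicalGroup G] [CompactSpace G]
  [MeasurableSpace G] [BorelSpace G] (μ : Measure G) [IsFiniteMeasure μ]

omit [Group G] [IsTopologicalGroup G] in
lemma continuous_integrable_of_compact {E : Type*} [NormedAddCommGroup E]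
    [SecondCountableTopology E] {f : G → E} (hf : Continuous f) : Integrable f μ :=
  hf.integrable_of_hasCompactSupport (HasCompactSupport.of_compactSpace f)

lemma integrable_averageHom (R S : CRep G) (A : (Fin S.dim → ℂ) →ₗ[ℂ] (Fin R.dim → ℂ)) (x) :
    Integrable (fun g => R.rep g (A (S.rep g⁻¹ x))) μ :=
  continuous_integrable_of_compact μ (R.continuous_rep_prod continuous_id
    (A.continuous_of_finiteDimensional.comp (S.continuous_rep_apply continuous_inv x)))

/-- The average `∫ R(g) A S(g⁻¹) dg` of a linear map. -/
def averageHom (R S : CRep G) (A : (Fin S.dim → ℂ) →ₗ[ℂ] (Fin R.dim → ℂ)) :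
    (Fin S.dim → ℂ) →ₗ[ℂ] (Fin R.dim → ℂ) where
  toFun x := ∫ g, R.rep g (A (S.rep g⁻¹ x)) ∂μ
  map_add' x y := by
    simp only [map_add]
    exact integral_add (integrable_averageHom μ R S A x) (integrable_averageHom μ R S A y)
  map_smul' c x := by
    simp only [map_smul, RingHom.id_apply]
    exact integral_smul c _

lemma averageHom_apply (R S : CRep G) (A : (Fin S.dim → ℂ) →ₗ[ℂ] (Fin R.dim → ℂ)) (x) :
    averageHom μ R S A x = ∫ g, R.rep g (A (S.rep g⁻¹ x)) ∂μ := rfl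

lemma averageHom_comm [μ.IsMulLeftInvariant] (R S : CRep G)
    (A : (Fin S.dim → ℂ) →ₗ[ℂ] (Fin R.dim → ℂ)) (h : G) (x) :
    averageHom μ R S A (S.rep h x) = R.rep h (averageHom μ R S A x) := by
  rw [averageHom_apply, averageHom_apply]
  have h1 := ContinuousLinearMap.integral_comp_comm (LinearMap.toContinuousLinearMap (R.rep h))
    (integrable_averageHom μ R S A x)
  simp only [LinearMap.coe_toContinuousLinearMap'] at h1
  rw [← h1]
  conv_lhs => rw [← integral_mul_left_eq_self _ h]
  congr 1
  funext g
  rw [map_mul, Module.End.mul_apply, ← Module.End.mul_apply (S.rep _) (S.rep h), ← map_mul]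
  simp

/-- Irreducible representations of a compact group with non-orthogonal characters are
isomorphic. -/
theorem CRep.iso_of_integral_character_ne_zero [μ.IsMulLeftInvariant] (R S : CRep G)
    [R.rep.IsIrreducible] [S.rep.IsIrreducible]
    (h : ∫ g, R.rep.character g * S.rep.character g⁻¹ ∂μ ≠ 0) : S.Iso R := by
  -- If every average vanished, matrix units A would give ∫ R(g)_kk S(g⁻¹)_ll = 0 for all k and l,
  -- and summing would kill the character integral.
  obtain ⟨A, hA⟩ : ∃ A, averageHom μ R S A ≠ 0 := by
    by_contra! h0
    apply h
    have hmat : ∀ k l, ∫ g, R.rep g (Pi.single k 1) k * S.rep g⁻¹ (Pi.single l 1) l ∂μ = 0 := by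
      intro k l
      have h1 := h0 ((LinearMap.single ℂ (fun _ => ℂ) k) ∘ₗ LinearMap.proj l)
      have h2 := congrFun (LinearMap.congr_fun h1 (Pi.single l 1)) k
      have h3 := ContinuousLinearMap.integral_comp_comm
        (ContinuousLinearMap.proj (R := ℂ) (φ := fun _ : Fin R.dim => ℂ) k)
        (integrable_averageHom μ R S
          ((LinearMap.single ℂ (fun _ => ℂ) k) ∘ₗ LinearMap.proj l) (Pi.single l 1))
      rw [averageHom_apply] at h2
      rw [ContinuousLinearMap.proj_apply, h2] at h3
      simp only [LinearMap.zero_apply, Pi.zero_apply] at h3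
      rw [← h3]
      congr 1
      funext g
      rw [ContinuousLinearMap.proj_apply, LinearMap.comp_apply, LinearMap.proj_apply,
        LinearMap.single_apply]
      have : (Pi.single k (S.rep g⁻¹ (Pi.single l 1) l) : Fin R.dim → ℂ) =
          (S.rep g⁻¹ (Pi.single l 1) l) • Pi.single k 1 := by
        rw [← Pi.single_smul, smul_eq_mul, mul_one]
      rw [this, map_smul, Pi.smul_apply, smul_eq_mul, mul_comm]
    simp only [character_eq_sum, Finset.sum_mul_sum]
    have hint : ∀ k l, Integrable
        (fun g => R.rep g (Pi.single k 1) k * S.rep g⁻¹ (Pi.single l 1) l) μ := fun k l =>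
      continuous_integrable_of_compact μ
        (((continuous_apply k).comp (R.continuous_rep _)).mul
          ((continuous_apply l).comp (S.continuous_rep_apply continuous_inv _)))
    rw [integral_finsetSum _ fun k _ => integrable_finsetSum _ fun l _ => hint k l]
    refine Finset.sum_eq_zero fun k _ => ?_
    rw [integral_finsetSum _ fun l _ => hint k l]
    exact Finset.sum_eq_zero fun l _ => hmat k l
  let Φ : Representation.IntertwiningMap S.rep R.rep :=
    ⟨averageHom μ R S A, fun g => LinearMap.ext fun x => averageHom_comm μ R S A g x⟩
  rcases Representation.IsIrreducible.bijective_or_eq_zero Φ with hb | h0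
  · exact ⟨Representation.IntertwiningMap.ofBijective Φ hb⟩
  · exact absurd (congrArg Representation.IntertwiningMap.toLinearMap h0) hA

end Averaging

/-! ## Haar measure on `SU(N)` -/

instance instIsTopologicalGroupSU (N : ℕ) : IsTopologicalGroup (SU N) where
  continuous_inv := by
    refine Continuous.subtype_mk ?_ _
    exact (continuous_subtype_val (p := fun A => A ∈ Matrix.specialUnitaryGroup (Fin N) ℂ)).star

instance instCompactSpaceSU (N : ℕ) : CompactSpace (SU N) := by
  apply isCompact_iff_compactSpace.mp
  have hK : IsCompact (Set.pi Set.univ fun _ : Fin N => Set.pi Set.univ fun _ : Fin N =>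
      Metric.closedBall (0 : ℂ) 1) :=
    isCompact_univ_pi fun _ => isCompact_univ_pi fun _ => isCompact_closedBall _ _
  refine hK.of_isClosed_subset ?_ ?_
  · have h : ((Matrix.specialUnitaryGroup (Fin N) ℂ : Set (Matrix (Fin N) (Fin N) ℂ))) =
        {A | A * star A = 1} ∩ {A | A.det = 1} := by
      ext A
      simp [Matrix.mem_specialUnitaryGroup_iff, Matrix.mem_unitaryGroup_iff]
    rw [h]
    refine IsClosed.inter (isClosed_eq ?_ continuous_const) (isClosed_eq ?_ continuous_const)
    · exact Continuous.mul continuous_id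
        (continuous_star (R := Matrix (Fin N) (Fin N) ℂ))
    · exact continuous_id.matrix_det
  · intro A hA i _ j _
    have := entry_norm_bound_of_unitary (Matrix.mem_specialUnitaryGroup_iff.mp hA).1 i j
    simpa using this

instance instMeasurableSpaceSU (N : ℕ) : MeasurableSpace (SU N) := borel _

instance instBorelSpaceSU (N : ℕ) : BorelSpace (SU N) := ⟨rfl⟩

lemma integral_normSq_trace_pos {N : ℕ} (hN : 0 < N) (μ : Measure (SU N)) [μ.IsHaarMeasure] :
    0 < ∫ U : SU N, ‖(U : Matrix (Fin N) (Fin N) ℂ).trace‖ ^ 2 ∂μ := by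
  have hcont : Continuous fun U : SU N => ‖(U : Matrix (Fin N) (Fin N) ℂ).trace‖ ^ 2 :=
    (continuous_subtype_val.matrix_trace.norm).pow 2
  refine hcont.integral_pos_of_hasCompactSupport_nonneg_nonzero
    (HasCompactSupport.of_compactSpace _) (fun U => by positivity) (x := 1) ?_
  simp [hN.ne']

lemma trace_inv {N : ℕ} (U : SU N) : ((U⁻¹ : SU N) : Matrix (Fin N) (Fin N) ℂ).trace =
    star (U : Matrix (Fin N) (Fin N) ℂ).trace := by
  change (star (U : Matrix (Fin N) (Fin N) ℂ)).trace = _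
  rw [Matrix.star_eq_conjTranspose, Matrix.trace_conjTranspose]

/-! ## Sectors with the weights of the fundamental representation -/

/-- Weyl symmetry: a permutation matrix may have determinant -1, but a scalar multiple lies in SU(N)
and conjugates in the same way. -/
lemma torus_perm {N : ℕ} (hN : 0 < N) (σ : Equiv.Perm (Fin N)) :
    ∃ u : SU N, ∀ φ : Fin N → ℝ, torus (φ ∘ σ) = u * torus φ * u⁻¹ := by
  set P : Matrix (Fin N) (Fin N) ℂ := (1 : Matrix (Fin N) (Fin N) ℂ).submatrix σ id with hP
  have hPs : star P = (1 : Matrix (Fin N) (Fin N) ℂ).submatrix id σ := by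
    rw [Matrix.star_eq_conjTranspose, hP, Matrix.conjTranspose_submatrix, Matrix.conjTranspose_one]
  have hconj : ∀ X : Matrix (Fin N) (Fin N) ℂ, P * X * star P = X.submatrix σ σ := by
    intro X
    rw [hPs, hP]
    have h1 : (1 : Matrix (Fin N) (Fin N) ℂ).submatrix σ id * X = X.submatrix σ id := by
      conv_lhs => rw [← Matrix.submatrix_id_id X]
      rw [← Matrix.submatrix_mul _ _ _ _ _ Function.bijective_id, Matrix.one_mul]
    rw [h1, ← Matrix.submatrix_mul _ _ _ _ _ Function.bijective_id, Matrix.mul_one]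
  have hPu : P ∈ Matrix.unitaryGroup (Fin N) ℂ := by
    rw [Matrix.mem_unitaryGroup_iff]
    have := hconj 1
    rw [Matrix.mul_one] at this
    rw [this, Matrix.submatrix_one_equiv]
  obtain ⟨u, hu⟩ := exists_SU_conj hN ⟨P, hPu⟩
  refine ⟨u, fun φ => Subtype.ext ?_⟩
  change _ = (u : Matrix (Fin N) (Fin N) ℂ) * (torus φ : Matrix (Fin N) (Fin N) ℂ) *
    star (u : Matrix (Fin N) (Fin N) ℂ)
  rw [hu, hconj, coe_torus, coe_torus, Matrix.submatrix_diagonal_equiv]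
  congr 1
  funext j
  simp only [Function.comp_apply, centered]
  rw [Equiv.sum_comp σ φ]

lemma IsWeightBasis.character_torus {N : ℕ} {R : CRep (SU N)} {b m} (h : IsWeightBasis R b m)
    (φ : Fin N → ℝ) : R.rep.character (torus φ) =
      ∑ i, Complex.exp (Complex.I * (((∑ j, m i j * φ j) / N : ℝ) : ℂ)) := by
  rw [Representation.character, LinearMap.trace_eq_matrix_trace ℂ b, Matrix.trace]
  refine Finset.sum_congr rfl fun i _ => ?_
  rw [Matrix.diag_apply, LinearMap.toMatrix_apply, h]
  simp

lemma sum_fundamental_weight {N : ℕ} (hN : 0 < N) (i : Fin N) (φ : Fin N → ℝ) :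
    (∑ j, (((N : ℤ) * (Pi.single i 1 : Fin N → ℤ) j - 1 : ℤ) : ℝ) * φ j) / N = centered φ i := by
  have hN' : (N : ℝ) ≠ 0 := by positivity
  push_cast
  simp only [sub_mul, one_mul, Finset.sum_sub_distrib, Pi.single_apply, Int.cast_ite, Int.cast_one,
    Int.cast_zero, mul_ite, mul_one, mul_zero, ite_mul, zero_mul, Finset.sum_ite_eq',
    Finset.mem_univ, if_true, centered]
  field_simp

/-- If all weights are weights of the fundamental representation, then the character is
proportional to the fundamental one. -/
lemma character_of_fundamental_weights {N : ℕ} (hN : 0 < N) {R : CRep (SU N)} {b m}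
    (h : IsWeightBasis R b m) {σ : Fin R.dim → Fin N}
    (hm : ∀ i, m i = fun j => (N : ℤ) * (Pi.single (σ i) 1 : Fin N → ℤ) j - 1) (U : SU N) :
    (N : ℂ) * R.rep.character U = R.dim * (U : Matrix (Fin N) (Fin N) ℂ).trace := by
  obtain ⟨u, φ, rfl⟩ := exists_conj_torus hN U
  have : NeZero N := ⟨hN.ne'⟩
  -- Cyclic shifts suffice as Weyl elements: they act simply transitively on the indices, so the sum
  -- over k turns each exponential into the full trace, whatever σ is.
  have h1 : ∀ k : Fin N, R.rep.character (torus φ) =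
      ∑ i, Complex.exp (Complex.I * centered φ (σ i + k)) := by
    intro k
    obtain ⟨w, hw⟩ := torus_perm hN (Equiv.addRight k)
    rw [← Representation.char_conj _ (torus φ) w, ← hw, h.character_torus]
    refine Finset.sum_congr rfl fun i _ => ?_
    rw [hm i, sum_fundamental_weight hN]
    simp only [centered, Function.comp_apply]
    rw [Equiv.sum_comp (Equiv.addRight k) φ, Equiv.coe_addRight]
  have h2 : ((u * torus φ * u⁻¹ : SU N) : Matrix (Fin N) (Fin N) ℂ).trace =
      ∑ k, Complex.exp (Complex.I * centered φ k) := by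
    rw [← character_fundamental, Representation.char_conj, character_fundamental, coe_torus,
      Matrix.trace_diagonal]
  have h3 : ∑ _k : Fin N, R.rep.character (torus φ) =
      ∑ i, ∑ k, Complex.exp (Complex.I * centered φ (σ i + k)) := by
    rw [Finset.sum_comm]
    exact Finset.sum_congr rfl fun k _ => h1 k
  rw [Representation.char_conj, h2]
  rw [Finset.sum_const, Finset.card_univ, Fintype.card_fin, nsmul_eq_mul] at h3
  rw [h3]
  have h4 : ∀ i, ∑ k, Complex.exp (Complex.I * centered φ (σ i + k)) =
      ∑ k, Complex.exp (Complex.I * centered φ k) := fun i =>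
    Equiv.sum_comp (Equiv.addLeft (σ i)) fun k => Complex.exp (Complex.I * centered φ k)
  simp [h4]

/-! ## The fundamental representation is irreducible -/

/-- Flipping the signs of two coordinates is in SU(N) and isolates v_a e_a + v_b e_b. With a third
index c, the pairs ab + ac - bc isolate e_a; this is where N > 2 enters. Permutations, up to
scalars, then reach every basis vector. -/
lemma eq_top_of_SU_invariant {N : ℕ} (hN : 2 < N) (W : Submodule ℂ (Fin N → ℂ)) (hW : W ≠ ⊥)
    (hinv : ∀ (U : SU N), ∀ v ∈ W, (U : Matrix (Fin N) (Fin N) ℂ) *ᵥ v ∈ W) : W = ⊤ := by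
  have hN0 : 0 < N := by omega
  have hpair : ∀ v ∈ W, ∀ a b : Fin N, a ≠ b →
        Pi.single a (v a) + Pi.single b (v b) ∈ W := by
    intro v hv a b hab
    have h1 := hinv (torus (Pi.single a Real.pi - Pi.single b Real.pi)) v hv
    have h2 : ((torus (Pi.single a Real.pi - Pi.single b Real.pi) : SU N) :
        Matrix (Fin N) (Fin N) ℂ) *ᵥ v = v - (2 : ℂ) • (Pi.single a (v a) + Pi.single b (v b)) := by
      rw [coe_torus, centered_of_sum_eq_zero (by simp [Finset.sum_sub_distrib])]
      funext k
      have hm : Complex.exp (-(Complex.I * Real.pi)) = -1 := by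
        rw [Complex.exp_neg, mul_comm, Complex.exp_pi_mul_I]; norm_num
      have hp : Complex.exp (Complex.I * Real.pi) = -1 := by
        rw [mul_comm, Complex.exp_pi_mul_I]
      simp only [Matrix.mulVec_diagonal, Pi.sub_apply, Pi.smul_apply, Pi.add_apply, smul_eq_mul,
        Pi.single_apply]
      by_cases hka : k = a
      · subst hka
        simp only [hab, if_true, if_false, sub_zero, hp]
        ring
      · by_cases hkb : k = b
        · subst hkb
          simp only [hka, if_true, if_false, zero_sub, Complex.ofReal_neg, mul_neg, hm]
          ring
        · simp [hka, hkb]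
    rw [h2] at h1
    have h3 := W.smul_mem (1 / 2 : ℂ) (W.sub_mem hv h1)
    rwa [sub_sub_cancel v, smul_smul, one_div, inv_mul_cancel₀ two_ne_zero, one_smul] at h3
  obtain ⟨v, hv, hv0⟩ := Submodule.exists_mem_ne_zero_of_ne_bot hW
  obtain ⟨a, ha⟩ : ∃ a, v a ≠ 0 := Function.ne_iff.mp hv0
  have : 2 < Fintype.card (Fin N) := by simpa using hN
  obtain ⟨b, hab⟩ : ∃ b : Fin N, b ≠ a :=
    Fintype.exists_ne_of_one_lt_card (by omega) a
  obtain ⟨c, hc⟩ : ∃ c : Fin N, c ∉ ({a, b} : Finset (Fin N)) := by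
    by_contra! h
    have h1 := Finset.card_le_card (fun x _ => h x : Finset.univ ⊆ ({a, b} : Finset (Fin N)))
    rw [Finset.card_univ] at h1
    have h2 := Finset.card_le_two (a := a) (b := b)
    omega
  simp only [Finset.mem_insert, Finset.mem_singleton, not_or] at hc
  have hea : (Pi.single a 1 : Fin N → ℂ) ∈ W := by
    have h1 := hpair v hv a b hab.symm
    have h2 := hpair v hv a c (Ne.symm hc.1)
    have h3 := hpair v hv b c (Ne.symm hc.2)
    have h4 := W.smul_mem (2 * v a)⁻¹
      (W.sub_mem (W.add_mem h1 h2) h3)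
    have h5 : (2 * v a)⁻¹ • (Pi.single a (v a) + Pi.single b (v b) +
        (Pi.single a (v a) + Pi.single c (v c)) - (Pi.single b (v b) + Pi.single c (v c))) =
        (Pi.single a 1 : Fin N → ℂ) := by
      have h6 : Pi.single a (v a) + Pi.single b (v b) + (Pi.single a (v a) + Pi.single c (v c)) -
          (Pi.single b (v b) + Pi.single c (v c)) = (2 : ℂ) • (Pi.single a (v a) : Fin N → ℂ) := by
        module
      rw [h6, smul_smul, ← Pi.single_smul, smul_eq_mul]
      congr 1
      field_simp
    rwa [h5] at h4
  have hall : ∀ k, (Pi.single k 1 : Fin N → ℂ) ∈ W := by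
    intro k
    set P : Matrix (Fin N) (Fin N) ℂ :=
      (1 : Matrix (Fin N) (Fin N) ℂ).submatrix (Equiv.swap a k) id with hP
    have hPu : P ∈ Matrix.unitaryGroup (Fin N) ℂ := by
      rw [Matrix.mem_unitaryGroup_iff, Matrix.star_eq_conjTranspose, hP,
        Matrix.conjTranspose_submatrix, Matrix.conjTranspose_one,
        ← Matrix.submatrix_mul _ _ _ _ _ Function.bijective_id, Matrix.mul_one,
        Matrix.submatrix_one_equiv]
    obtain ⟨u, c, hcc, hu⟩ := exists_SU_eq_smul hN0 ⟨P, hPu⟩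
    have h1 := W.smul_mem (star c) (hinv u _ hea)
    have h2 : P *ᵥ Pi.single a 1 = (Pi.single k 1 : Fin N → ℂ) := by
      funext l
      rw [Matrix.mulVec_single_one, Matrix.col_apply, hP, Matrix.submatrix_apply, id,
        Matrix.one_apply, Pi.single_apply]
      congr 1
      rw [Equiv.swap_apply_eq_iff, Equiv.swap_apply_left]
    rw [hu, Matrix.smul_mulVec, smul_smul, mul_comm, hcc, one_smul] at h1
    rwa [← h2]
  rw [eq_top_iff]
  intro w _
  rw [pi_eq_sum_univ' w]
  exact Submodule.sum_mem _ fun k _ => W.smul_mem _ (hall k)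

lemma fundamental_isIrreducible {N : ℕ} (hN : 2 < N) : (fundamental N).rep.IsIrreducible := by
  have hN0 : 0 < N := by omega
  have hne : Nontrivial (Subrepresentation (fundamental N).rep) := by
    refine ⟨⟨⊥, ⊤, fun h => ?_⟩⟩
    have h1 : (⊥ : Submodule ℂ (Fin N → ℂ)) = ⊤ := congrArg Subrepresentation.toSubmodule h
    have : Nonempty (Fin N) := ⟨⟨0, hN0⟩⟩
    exact bot_ne_top h1
  refine { toNontrivial := hne, eq_bot_or_eq_top := fun W => ?_ }
  by_cases hW : W.toSubmodule = ⊥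
  · exact Or.inl (Subrepresentation.toSubmodule_injective hW)
  · exact Or.inr (Subrepresentation.toSubmodule_injective
      (eq_top_of_SU_invariant hN W.toSubmodule hW fun U v hv => W.apply_mem_toSubmodule U hv))

/-- The characters are proportional, so their pairing is (dim R / N) ∫ |Tr U|² > 0. The dimension of
R need not be known in advance. -/
theorem iso_fundamental_of_weights {N : ℕ} (hN : 2 < N) {R : CRep (SU N)} {b m}
    (h : IsWeightBasis R b m) [R.rep.IsIrreducible] {σ : Fin R.dim → Fin N}
    (hm : ∀ i, m i = fun j => (N : ℤ) * (Pi.single (σ i) 1 : Fin N → ℤ) j - 1) :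
    (fundamental N).Iso R := by
  have hN0 : 0 < N := by omega
  have := fundamental_isIrreducible hN
  refine CRep.iso_of_integral_character_ne_zero (Measure.haarMeasure ⊤) R (fundamental N) ?_
  have hN' : (N : ℂ) ≠ 0 := by exact_mod_cast hN0.ne'
  have h1 : ∀ U : SU N, R.rep.character U * (fundamental N).rep.character U⁻¹ =
      ((R.dim / N * ‖(U : Matrix (Fin N) (Fin N) ℂ).trace‖ ^ 2 : ℝ) : ℂ) := by
    intro U
    have h2 : R.rep.character U = R.dim / N * (U : Matrix (Fin N) (Fin N) ℂ).trace := by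
      have := character_of_fundamental_weights hN0 h hm U
      field_simp
      linear_combination this
    rw [h2, character_fundamental, trace_inv, mul_assoc, Complex.star_def, Complex.mul_conj,
      Complex.normSq_eq_norm_sq]
    push_cast
    ring
  simp only [h1]
  rw [integral_complex_ofReal, integral_const_mul]
  have hd : 0 < R.dim := Fin.pos_iff_nonempty.mpr R.nonempty_fin_dim
  have := integral_normSq_trace_pos hN0 (Measure.haarMeasure (⊤ : TopologicalSpace.PositiveCompacts (SU N)))
  exact_mod_cast (by positivity : 0 < (R.dim : ℝ) / N * _).ne'

/-! ## Isomorphisms and charge conjugation -/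

section Iso

variable {G : Type} [Group G] [TopologicalSpace G] {R S T : CRep G}

lemma CRep.Iso.refl (R : CRep G) : R.Iso R := ⟨Representation.Equiv.refl R.rep⟩

lemma CRep.Iso.symm (h : R.Iso S) : S.Iso R := ⟨h.some.symm⟩

lemma CRep.Iso.trans (h : R.Iso S) (h' : S.Iso T) : R.Iso T := ⟨h.some.trans h'.some⟩

lemma CRep.Iso.dim_eq (h : R.Iso S) : R.dim = S.dim := by
  have := h.some.toLinearEquiv.finrank_eq
  simpa using this

lemma CRep.Iso.character_eq (h : R.Iso S) : R.rep.character = S.rep.character :=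
  Representation.char_iso h.some

lemma CRep.Iso.isIrreducible (h : R.Iso S) (hR : R.rep.IsIrreducible) : S.rep.IsIrreducible := by
  obtain ⟨e⟩ := h
  let f : Subrepresentation R.rep → Subrepresentation S.rep := fun W =>
    ⟨W.toSubmodule.map e.toLinearEquiv.toLinearMap, by
      rintro g _ ⟨v, hv, rfl⟩
      exact ⟨R.rep g v, W.apply_mem_toSubmodule g hv, e.toIntertwiningMap.isIntertwining _ _ g v⟩⟩
  let f' : Subrepresentation S.rep → Subrepresentation R.rep := fun W =>
    ⟨W.toSubmodule.map e.symm.toLinearEquiv.toLinearMap, by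
      rintro g _ ⟨v, hv, rfl⟩
      exact ⟨S.rep g v, W.apply_mem_toSubmodule g hv, e.symm.toIntertwiningMap.isIntertwining _ _ g v⟩⟩
  have hle : ∀ W W', f W ≤ f W' ↔ W ≤ W' := fun W W' =>
    Submodule.map_le_map_iff_of_injective e.toLinearEquiv.injective _ _
  have hinv : ∀ W, f (f' W) = W := fun W => Subrepresentation.toSubmodule_injective (by
    ext v
    constructor
    · rintro ⟨_, ⟨w, hw, rfl⟩, rfl⟩
      have : e.toLinearEquiv.toLinearMap (e.symm.toLinearEquiv.toLinearMap w) = w :=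
        e.apply_symm_apply w
      rw [this]; exact hw
    · intro hv
      exact ⟨_, ⟨v, hv, rfl⟩, e.apply_symm_apply v⟩)
  have hinv' : ∀ W, f' (f W) = W := fun W => by
    apply le_antisymm <;> rw [← hle, hinv]
  exact (OrderIso.isSimpleOrder_iff
    ({ toFun := f, invFun := f', left_inv := hinv', right_inv := hinv, map_rel_iff' := hle _ _ } :
      Subrepresentation R.rep ≃o Subrepresentation S.rep)).mp hR

end Iso

variable {N : ℕ}

/-- An isomorphism carries a weight basis to a weight basis with the same m, and the Casimir
invariant depends only on m and the dimension. -/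
lemma CRep.Iso.casimir_eq (hN : 0 < N) {R S : CRep (SU N)} (h : R.Iso S) :
    R.casimir = S.casimir := by
  obtain ⟨b, m, hb⟩ := exists_isWeightBasis hN R
  obtain ⟨d, ρ, hρ⟩ := S
  obtain rfl : R.dim = d := h.dim_eq
  obtain ⟨e⟩ := h
  have hb' : IsWeightBasis (⟨R.dim, ρ, hρ⟩ : CRep (SU N)) (b.map e.toLinearEquiv) m := by
    intro i φ
    have h1 := e.toIntertwiningMap.isIntertwining _ _ (torus φ) (b i)
    rw [hb, map_smul] at h1
    exact h1.symm
  rw [hb.casimir_eq hN, hb'.casimir_eq hN]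

lemma CRep.Iso.energy_eq (hN : 0 < N) {R S : CRep (SU N)} (h : R.Iso S) (g : ℝ) :
    energy g R = energy g S := by rw [energy, energy, h.casimir_eq hN]

lemma CRep.Iso.orbifoldWilson_eq (hN : 0 < N) {R S : CRep (SU N)} (h : R.Iso S)
    (κ : CRep (SO N)) (g a : ℝ) : orbifoldWilson κ g a R = orbifoldWilson κ g a S := by
  simp only [orbifoldWilson, diskCorrelator, h.energy_eq hN, h.character_eq]

lemma CRep.Iso.survives (hN : 0 < N) {R S : CRep (SU N)} (h : R.Iso S) {κ : CRep (SO N)} {g a : ℝ}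
    (hR : Survives κ g a R) : Survives κ g a S :=
  ⟨h.isIrreducible hR.1, by rw [← h.orbifoldWilson_eq hN]; exact hR.2⟩

lemma chargeConj_chargeConj (U : SU N) : chargeConj N (chargeConj N U) = U := by
  apply Subtype.ext
  ext i j
  exact Complex.conj_conj _

lemma chargeConj_inclSO (u : SO N) : chargeConj N (inclSO N u) = inclSO N u := by
  apply Subtype.ext
  ext i j
  exact Complex.conj_ofReal _

lemma chargeConj_torus (φ : Fin N → ℝ) : chargeConj N (torus φ) = torus (-φ) := by
  apply Subtype.ext
  change (torus φ : Matrix (Fin N) (Fin N) ℂ).map (starRingEnd ℂ) = _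
  rw [coe_torus, coe_torus, Matrix.diagonal_map (map_zero _)]
  congr 1
  funext j
  rw [← Complex.exp_conj]
  congr 1
  simp [centered]
  ring

lemma CRep.conj_conj (R : CRep (SU N)) : R.conj.conj.Iso R :=
  ⟨Representation.Equiv.mk (LinearEquiv.refl ℂ _) fun U => by
    change R.rep (chargeConj N (chargeConj N U)) = R.rep U
    rw [chargeConj_chargeConj]⟩

lemma CRep.Iso.conj {R S : CRep (SU N)} (h : R.Iso S) : R.conj.Iso S.conj :=
  ⟨Representation.Equiv.mk h.some.toLinearEquiv fun U =>
    h.some.toIntertwiningMap.isIntertwining' (chargeConj N U)⟩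

lemma CRep.conj_isIrreducible {R : CRep (SU N)} (hR : R.rep.IsIrreducible) :
    R.conj.rep.IsIrreducible := by
  let e : Subrepresentation R.rep ≃o Subrepresentation R.conj.rep :=
    { toFun := fun W => ⟨W.toSubmodule, fun U v hv => W.apply_mem_toSubmodule (chargeConj N U) hv⟩
      invFun := fun W => ⟨W.toSubmodule, fun U v hv => by
        have := W.apply_mem_toSubmodule (chargeConj N U) hv
        change R.rep (chargeConj N (chargeConj N U)) v ∈ W.toSubmodule at this
        rwa [chargeConj_chargeConj] at this⟩
      left_inv := fun W => rfl
      right_inv := fun W => rfl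
      map_rel_iff' := Iff.rfl }
  exact (OrderIso.isSimpleOrder_iff e).mp hR

lemma IsWeightBasis.conj {R : CRep (SU N)} {b m} (h : IsWeightBasis R b m) :
    IsWeightBasis R.conj b (-m) := by
  intro (i : Fin R.dim) φ
  have h1 := h i (-φ)
  rw [← chargeConj_torus] at h1
  have h2 : ∑ j, (m i j : ℝ) * (-φ) j = ∑ j, (((-m) i j : ℤ) : ℝ) * φ j := by simp
  rw [h2] at h1
  exact h1

lemma CRep.conj_casimir (hN : 0 < N) (R : CRep (SU N)) : R.conj.casimir = R.casimir := by
  obtain ⟨b, m, hb⟩ := exists_isWeightBasis hN R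
  have h1 : ∑ i, ∑ j, (-m) i j ^ 2 = ∑ i, ∑ j, m i j ^ 2 := by simp
  rw [hb.casimir_eq hN, hb.conj.casimir_eq hN, ← h1]
  rfl

lemma conj_energy (hN : 0 < N) (g : ℝ) (R : CRep (SU N)) : energy g R.conj = energy g R := by
  rw [energy, energy, R.conj_casimir hN]

lemma conj_character_inclSO (R : CRep (SU N)) (u : SO N) :
    R.conj.rep.character (inclSO N u) = R.rep.character (inclSO N u) := by
  change R.rep.character (chargeConj N (inclSO N u)) = _
  rw [chargeConj_inclSO]

lemma conj_orbifoldWilson (hN : 0 < N) (κ : CRep (SO N)) (g a : ℝ) (R : CRep (SU N)) :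
    orbifoldWilson κ g a R.conj = orbifoldWilson κ g a R := by
  simp only [orbifoldWilson, diskCorrelator, conj_energy hN, conj_character_inclSO]

lemma conj_orbifoldSector (hN : 0 < N) (κ : CRep (SO N)) (g a : ℝ) (h : ℕ) (R : CRep (SU N)) :
    orbifoldSector κ g a h R.conj = orbifoldSector κ g a h R := by
  simp only [orbifoldSector, closedSector, conj_energy hN, conj_character_inclSO]
  rfl

theorem chargeConjSymmetric (hN : 0 < N) (κ : CRep (SO N)) (g a : ℝ) :
    ChargeConjSymmetric κ g a := fun R hR =>
  ⟨R.conj_isIrreducible hR, conj_energy hN g R, conj_orbifoldWilson hN κ g a R,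
    fun h => conj_orbifoldSector hN κ g a h R⟩

lemma Survives.conj (hN : 0 < N) {κ : CRep (SO N)} {g a : ℝ} {R : CRep (SU N)}
    (h : Survives κ g a R) : Survives κ g a R.conj :=
  ⟨R.conj_isIrreducible h.1, by rw [conj_orbifoldWilson hN]; exact h.2⟩

/-! ## The fundamental sector -/

lemma fundamental_isWeightBasis (hN : 0 < N) :
    IsWeightBasis (fundamental N) (Pi.basisFun ℂ (Fin N))
      fun i j => (N : ℤ) * (Pi.single i 1 : Fin N → ℤ) j - 1 := by
  have key : ∀ (i : Fin N) (φ : Fin N → ℝ),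
      (torus φ : Matrix (Fin N) (Fin N) ℂ) *ᵥ (Pi.basisFun ℂ (Fin N) i) =
        Complex.exp (Complex.I * centered φ i) • Pi.basisFun ℂ (Fin N) i := by
    intro i φ
    rw [Pi.basisFun_apply, coe_torus, Matrix.mulVec_single_one]
    funext k
    rcases eq_or_ne k i with rfl | hki
    · simp
    · simp [hki]
  intro i φ
  rw [sum_fundamental_weight hN i φ]
  exact key i φ

lemma sum_fundamental_weight_sq (i : Fin N) :
    ∑ j, ((N : ℤ) * (Pi.single i 1 : Fin N → ℤ) j - 1) ^ 2 = (N : ℤ) * (N - 1) := by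
  have h1 : ∀ j, ((N : ℤ) * (Pi.single i 1 : Fin N → ℤ) j - 1) ^ 2 =
      (if j = i then (N : ℤ) ^ 2 - 2 * N else 0) + 1 := by
    intro j
    rw [Pi.single_apply]
    split_ifs <;> ring
  simp only [h1, Finset.sum_add_distrib, Finset.sum_ite_eq', Finset.mem_univ, if_true,
    Finset.sum_const, Finset.card_univ, Fintype.card_fin, nsmul_eq_mul]
  ring

/-- On SO(N) the fundamental character is χ_κ itself, which is real, so the integrand is a positive
constant times a square that is N² at the identity. -/
lemma fundamental_survives (hN : 2 < N) (g a : ℝ) :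
    Survives (vectorRep N) g a (fundamental N) := by
  refine ⟨fundamental_isIrreducible hN, ?_⟩
  have h1 : ∀ u : SO N, (vectorRep N).rep.character u * diskCorrelator g a (inclSO N u) (fundamental N) =
      (((u : Matrix (Fin N) (Fin N) ℝ).trace ^ 2 * Real.exp (-a * energy g (fundamental N)) : ℝ) : ℂ) := by
    intro u
    have h2 : (fundamental N).rep.character (inclSO N u) = (vectorRep N).rep.character u := rfl
    rw [diskCorrelator, h2, character_vectorRep]
    push_cast
    ring
  unfold orbifoldWilson
  simp only [h1]
  rw [integral_complex_ofReal, integral_mul_const]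
  have hcont : Continuous fun u : SO N => (u : Matrix (Fin N) (Fin N) ℝ).trace ^ 2 :=
    continuous_subtype_val.matrix_trace.pow 2
  have hpos : 0 < ∫ u : SO N, (u : Matrix (Fin N) (Fin N) ℝ).trace ^ 2 ∂haarSO N := by
    refine hcont.integral_pos_of_hasCompactSupport_nonneg_nonzero
      (HasCompactSupport.of_compactSpace _) (fun u => by positivity) (x := 1) ?_
    have : N ≠ 0 := by omega
    simp [this]
  exact_mod_cast (mul_pos hpos (Real.exp_pos _)).ne'

/-- The center separates them: exp (-2πi/N) is not real for N > 2, so it differs from its conjugate.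
-/
lemma fundamental_not_iso_antifundamental (hN : 2 < N) :
    ¬ (fundamental N).Iso (antifundamental N) := by
  intro h
  have hN0 : 0 < N := by omega
  let z : SU N := torus (Pi.single ⟨0, hN0⟩ (2 * Real.pi))
  have h1 := congrFun h.character_eq z
  have h2 : (antifundamental N).rep.character z = (fundamental N).rep.character (chargeConj N z) := rfl
  have h3 : ((chargeConj N z : SU N) : Matrix (Fin N) (Fin N) ℂ) =
      (z : Matrix (Fin N) (Fin N) ℂ).map (starRingEnd ℂ) := rfl
  have hz := coe_torus_single hN0 ⟨0, hN0⟩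
  have hN' : (N : ℂ) ≠ 0 := by exact_mod_cast hN0.ne'
  rw [h2, character_fundamental, character_fundamental, h3, ← AddMonoidHom.map_trace, hz,
    Matrix.trace_smul, Matrix.trace_one, Fintype.card_fin, smul_eq_mul, map_mul, map_natCast] at h1
  have h4 := mul_right_cancel₀ hN' h1
  have h5 := congrArg Complex.im h4
  rw [Complex.conj_im, Complex.exp_im] at h5
  have h6 : (-(2 * (Real.pi : ℂ) * Complex.I / N)) = ((-(2 * Real.pi / N) : ℝ) : ℂ) * Complex.I := by
    push_cast; ring
  rw [h6, Complex.re_ofReal_mul, Complex.im_ofReal_mul] at h5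
  simp only [Complex.I_re, Complex.I_im, mul_zero, mul_one, Real.exp_zero, one_mul, Real.sin_neg] at h5
  have hNr : (2 : ℝ) < N := by exact_mod_cast hN
  have h7 : 0 < Real.sin (2 * Real.pi / N) := by
    have := Real.pi_pos
    refine Real.sin_pos_of_pos_of_lt_pi (by positivity) ?_
    rw [div_lt_iff₀ (by linarith)]
    nlinarith
  linarith

/-! ## The vacua -/

/-- Every surviving sector has at least the Casimir invariant of the fundamental one. -/
lemma Survives.casimir_bound (hNe : Even N) (hN : 2 < N) {g a : ℝ} {R : CRep (SU N)}
    (h : Survives (vectorRep N) g a R) :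
    (fundamental N).casimir ≤ R.casimir ∧ (R.casimir = (fundamental N).casimir →
      R.Iso (fundamental N) ∨ R.Iso (antifundamental N)) := by
  have hN0 : 0 < N := by omega
  have hNr : (0 : ℝ) < N := by exact_mod_cast hN0
  have hirr := h.1
  have hirr' := R.conj_isIrreducible hirr
  have hd : (0 : ℝ) < R.dim := by exact_mod_cast Fin.pos_iff_nonempty.mpr R.nonempty_fin_dim
  obtain ⟨b, m, hb⟩ := exists_isWeightBasis hN0 R
  obtain ⟨r, hr0, hrN, hr⟩ := hb.exists_nality hNe hN0 h
  have hbound := fun i => weight_norm_bound (hb.sum_eq_zero hN0 i) hr0 hrN (hr i)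
  -- The fundamental value is rewritten as a sum over the weights of R, which makes the comparison
  -- termwise.
  have hF : (fundamental N).casimir =
      (N + 1) / (N ^ 2 * R.dim) * ((∑ _i : Fin R.dim, (N : ℤ) * (N - 1) : ℤ) : ℝ) := by
    rw [(fundamental_isWeightBasis hN0).casimir_eq hN0]
    have h1 : ∑ i : Fin N, ∑ j, ((N : ℤ) * (Pi.single i 1 : Fin N → ℤ) j - 1) ^ 2 =
        N * ((N : ℤ) * (N - 1)) := by
      simp only [sum_fundamental_weight_sq, Finset.sum_const, Finset.card_univ, Fintype.card_fin,
        nsmul_eq_mul]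
    have h2 : (∑ i : Fin (fundamental N).dim, ∑ j, ((N : ℤ) * (Pi.single i 1 : Fin N → ℤ) j - 1) ^ 2) =
        N * ((N : ℤ) * (N - 1)) := h1
    rw [h2]
    change ((N : ℝ) + 1) / (N ^ 2 * N) * _ = _
    simp only [Finset.sum_const, Finset.card_univ, Fintype.card_fin, nsmul_eq_mul]
    push_cast
    field_simp
  have hc : 0 < ((N : ℝ) + 1) / (N ^ 2 * R.dim) := by positivity
  rw [hF, hb.casimir_eq hN0]
  refine ⟨mul_le_mul_of_nonneg_left ?_ hc.le, fun heq => ?_⟩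
  · exact_mod_cast Finset.sum_le_sum fun i _ => (hbound i).1
  · have h1 : ∑ i, ∑ j, m i j ^ 2 = ∑ _i : Fin R.dim, (N : ℤ) * (N - 1) := by
      exact_mod_cast mul_left_cancel₀ hc.ne' heq
    have h2 := (Finset.sum_eq_sum_iff_of_le fun i _ => (hbound i).1).mp h1.symm
    have h3 := fun i => (hbound i).2 (h2 i (Finset.mem_univ i)).symm
    -- Since r is common to all weights, the two kinds of minimal weights cannot be mixed. If r = 1,
    -- the negated weights, those of the conjugate of R, are fundamental.
    by_cases hrc : r = N - 1
    · have h4 : ∀ i, ∃ k, m i = fun j => (N : ℤ) * (Pi.single k 1 : Fin N → ℤ) j - 1 := by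
        intro i
        rcases h3 i with h | h
        · exact h.2
        · have : (2 : ℤ) < N := by exact_mod_cast hN
          omega
      choose σ hσ using h4
      exact Or.inl (iso_fundamental_of_weights hN hb hσ).symm
    · have h4 : ∀ i, ∃ k, (-m) i = fun j => (N : ℤ) * (Pi.single k 1 : Fin N → ℤ) j - 1 := by
        intro i
        obtain ⟨k, hk⟩ := ((h3 i).resolve_left fun h => hrc h.1).2
        refine ⟨k, funext fun j => ?_⟩
        rw [Pi.neg_apply, Pi.neg_apply, hk]
        ring
      choose σ hσ using h4
      have h5 : (fundamental N).Iso R.conj := iso_fundamental_of_weights hN hb.conj hσ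
      exact Or.inr (R.conj_conj.symm.trans h5.symm.conj)

theorem isVacuum_iff (hNe : Even N) (hN : 2 < N) {g : ℝ} (hg : 0 < g) (a : ℝ) (R : CRep (SU N)) :
    IsVacuum (vectorRep N) g a R ↔ R.Iso (fundamental N) ∨ R.Iso (antifundamental N) := by
  have hN0 : 0 < N := by omega
  have hg2 : 0 < g ^ 2 / 2 := by positivity
  have hmin : ∀ S, Survives (vectorRep N) g a S → energy g (fundamental N) ≤ energy g S :=
    fun S hS => mul_le_mul_of_nonneg_left (hS.casimir_bound hNe hN).1 hg2.le
  have hfund := fundamental_survives hN g a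
  -- The antifundamental representation unfolds to the conjugate of the fundamental one.
  have hanti : energy g (antifundamental N) = energy g (fundamental N) :=
    conj_energy hN0 g (fundamental N)
  constructor
  · rintro ⟨hS, hle⟩
    refine (hS.casimir_bound hNe hN).2 (mul_left_cancel₀ hg2.ne' ?_)
    exact le_antisymm (hle _ hfund) (hmin _ hS)
  · rintro (h | h)
    · exact ⟨h.symm.survives hN0 hfund, fun S hS => (h.energy_eq hN0 g).trans_le (hmin S hS)⟩
    · exact ⟨h.symm.survives hN0 (hfund.conj hN0),
        fun S hS => ((h.energy_eq hN0 g).trans hanti).trans_le (hmin S hS)⟩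

end YM2

end

/-! ### Spontaneous breaking of charge conjugation -/

theorem proposition4p3 (N : ℕ) (hN : Even N) (hN2 : 2 < N) (g a : ℝ) (hg : 0 < g) (ha : 0 < a) :
    YM2.Survives (YM2.vectorRep N) g a (YM2.fundamental N) ∧
    YM2.Survives (YM2.vectorRep N) g a (YM2.antifundamental N) ∧
    YM2.energy g (YM2.fundamental N) = YM2.energy g (YM2.antifundamental N) ∧
    (∀ R : YM2.CRep (YM2.SU N), YM2.IsVacuum (YM2.vectorRep N) g a R ↔
      R.Iso (YM2.fundamental N) ∨ R.Iso (YM2.antifundamental N)) ∧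
    ¬ (YM2.fundamental N).Iso (YM2.antifundamental N) ∧
    (YM2.fundamental N).conj.Iso (YM2.antifundamental N) ∧
    (YM2.antifundamental N).conj.Iso (YM2.fundamental N) ∧
    YM2.ChargeConjSSB (YM2.vectorRep N) g a := by
  have hN0 : 0 < N := by omega
  have hfund := YM2.fundamental_survives hN2 g a
  have hvac := fun R => YM2.isVacuum_iff hN hN2 hg a R
  have hne := YM2.fundamental_not_iso_antifundamental hN2
  have hfa : (YM2.fundamental N).conj.Iso (YM2.antifundamental N) := YM2.CRep.Iso.refl _
  have haf : (YM2.antifundamental N).conj.Iso (YM2.fundamental N) :=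
    (YM2.fundamental N).conj_conj
  refine ⟨hfund, hfund.conj hN0, (YM2.conj_energy hN0 g _).symm, hvac, hne, hfa, haf,
    YM2.chargeConjSymmetric hN0 _ g a, ⟨_, (hvac _).mpr (Or.inl (YM2.CRep.Iso.refl _))⟩,
    fun R hR => ?_⟩
  -- Conjugation exchanges the two classes of vacua, so a fixed vacuum would identify □ with its
  -- conjugate.
  rcases (hvac R).mp hR with h | h
  · exact ⟨(hvac _).mpr (Or.inr (h.conj.trans hfa)),
      fun h' => hne (h.symm.trans (h'.symm.trans (h.conj.trans hfa)))⟩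
  · exact ⟨(hvac _).mpr (Or.inl (h.conj.trans haf)),
      fun h' => hne ((h.conj.trans haf).symm.trans (h'.trans h))⟩
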